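/- Let $\varepsilon\in\{-1,1\}$. Let $(M,g_M)$ be an odd-dimensional Lorentzian manifold with Levi-Civita connection $\nabla$, and let $\phi$ be a $(1,1)$-tensor field, $\xi$ a vector field and $\eta$ a $1$-form on $M$ such that for all vector fields $X,Y$ $$\phi^2X=\varepsilon X+\eta(X)\xi,\quad g_M(\phi X,\phi Y)=g_M(X,Y)+\eta(X)\eta(Y),\quad \eta(X)=\varepsilon g_M(X,\xi),\quad \eta(\xi)=-\varepsilon,$$ $$(\nabla_X\phi)Y=\varepsilon\, g_M(\phi X,\phi Y)\,\xi+\eta(Y)\,\phi^2X ,$$ that is, $M$ is a Lorentzian Sasakian manifold if $\varepsilon=-1$ and a Lorentzian para Sasakian manifold if $\varepsilon=1$. Let $(N,g_N)$ be a Lorentzian manifold and let $F:M\to N$ be a semi-Riemannian submersion onto $N$, i.e. a smooth surjective submersion whose fibres are semi-Riemannian submanifolds of $M$ and such that $F_*$ preserves scalar products of vectors orthogonal to the fibres. Assume that $F$ is anti-invariant, $\phi(\ker F_*)\subseteq(\ker F_*)^\perp$, and that $\xi$ is horizontal, i.e. $\xi\in\Gamma((\ker F_*)^\perp)$. Let $\mathcal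 V,\mathcal H$ be the orthogonal projections of $TM$ onto $\ker F_*$ and $(\ker F_*)^\perp$; let $\mu$ be the orthogonal complement of $\phi(\ker F_*)$ in $(\ker F_*)^\perp$; for horizontal $X$ write $\phi X=BX+CX$ with $BX=\mathcal V\phi X\in\Gamma(\ker F_*)$ and $CX=\mathcal H\phi X\in\Gamma(\mu)$; let $$\mathcal T_{X}Y=\mathcal H\nabla_{\mathcal VX}\mathcal VY+\mathcal V\nabla_{\mathcal VX}\mathcal HY,\qquad \mathcal A_{X}Y=\mathcal V\nabla_{\mathcal HX}\mathcal HY+\mathcal H\nabla_{\mathcal HX}\mathcal VY$$ be O'Neill's tensors; and let $(\nabla F_*)(X,Y)=\nabla^F_XF_*Y-F_*(\nabla_XY)$ be the second fundamental form of $F$, where $\nabla^F$ is the pullback to $F^{*}TN$ of the Levi-Civita connection of $g_N$. Then the following are equivalent: (a) $\ker F_*$ defines a totally geodesic foliation on $M$, i.e. it is integrable and the second fundamental form of its leaves vanishes; (b) $g_N\big((\nabla F_*)(V,\phi X),F_*\phi W\big)=0$ for all $X\in\Gamma((\ker F_*)^\perp)$ and $V,W\in\Gamma(\ker F_*)$;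 (c) $\mathcal T_VBX+\mathcal A_{CX}V\in\Gamma(\mu)$ for all $X\in\Gamma((\ker F_*)^\perp)$ and $V\in\Gamma(\ker F_*)$. -/

import Mathlib

open Bundle Set
open scoped Manifold ContDiff Bundle

noncomputable section

namespace SemiRiem

variable {E : Type*} [NormedAddCommGroup E] [NormedSpace ℝ E]
  {M : Type*} [TopologicalSpace M] [ChartedSpace E M] [IsManifold 𝓘(ℝ, E) ∞ M]
  {E' : Type*} [NormedAddCommGroup E'] [NormedSpace ℝ E']
  {N : Type*} [TopologicalSpace N] [ChartedSpace E' N] [IsManifold 𝓘(ℝ, E') ∞ N]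

/-- A vector field is smooth. -/
def IsSmoothField (X : ∀ x : M, TangentSpace 𝓘(ℝ, E) x) : Prop :=
  ContMDiff 𝓘(ℝ, E) (𝓘(ℝ, E).prod 𝓘(ℝ, E)) ∞ (fun x ↦ TotalSpace.mk' E x (X x))

/-- The coordinates on `T_y M` given by the preferred chart of `M` at `x`. -/
def toCoord (x y : M) : TangentSpace 𝓘(ℝ, E) y →L[ℝ] E :=
  (trivializationAt E (TangentSpace 𝓘(ℝ, E)) x).continuousLinearMapAt ℝ y

/-- The coordinate vectors on `T_y M` given by the preferred chart of `M` at `x`: the inverse of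
`toCoord x y` for `y` in the domain of the chart. -/
def ofCoord (x y : M) : E →L[ℝ] TangentSpace 𝓘(ℝ, E) y :=
  (trivializationAt E (TangentSpace 𝓘(ℝ, E)) x).symmL ℝ y

theorem mdifferentiableAt_toCoord {Y : ∀ x : M, TangentSpace 𝓘(ℝ, E) x} {x : M}
    (hY : MDiffAt (T% Y) x) : MDiffAt (fun y ↦ toCoord x y (Y y)) x := by
  rw [mdifferentiableAt_section] at hY
  refine hY.congr_of_eventuallyEq ?_
  filter_upwards [(trivializationAt E (TangentSpace 𝓘(ℝ, E)) x).open_baseSet.mem_nhds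
    (mem_baseSet_trivializationAt E (TangentSpace 𝓘(ℝ, E)) x)] with y hy
  exact Trivialization.continuousLinearMapAt_apply_of_mem ℝ _ hy _

theorem ofCoord_toCoord (x : M) (v : TangentSpace 𝓘(ℝ, E) x) :
    ofCoord x x (toCoord x x v) = v :=
  Trivialization.symmL_continuousLinearMapAt _
    (mem_baseSet_trivializationAt E (TangentSpace 𝓘(ℝ, E)) x) v

variable [FiniteDimensional ℝ E] [FiniteDimensional ℝ E']

/-- A smooth semi-Riemannian metric on `M`: a smooth field of nondegenerate symmetric
bilinear forms on the tangent spaces. -/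
structure SemiRiemannianMetric (E : Type*) [NormedAddCommGroup E] [NormedSpace ℝ E]
    [FiniteDimensional ℝ E] (M : Type*) [TopologicalSpace M] [ChartedSpace E M]
    [IsManifold 𝓘(ℝ, E) ∞ M] where
  /-- The scalar product on each tangent space. -/
  inner (x : M) : TangentSpace 𝓘(ℝ, E) x →L[ℝ] TangentSpace 𝓘(ℝ, E) x →L[ℝ] ℝ
  symm (x : M) (v w : TangentSpace 𝓘(ℝ, E) x) : inner x v w = inner x w v
  nondegenerate (x : M) (v : TangentSpace 𝓘(ℝ, E) x) (hv : ∀ w, inner x v w = 0) : v = 0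
  contMDiff : ContMDiff 𝓘(ℝ, E) (𝓘(ℝ, E).prod 𝓘(ℝ, E →L[ℝ] E →L[ℝ] ℝ)) ∞
    (fun x ↦ TotalSpace.mk' (E →L[ℝ] E →L[ℝ] ℝ) x (inner x))

/-- The metric has index one at every point: there is a timelike vector whose orthogonal
complement is positive definite. -/
def SemiRiemannianMetric.IsLorentzian (g : SemiRiemannianMetric E M) : Prop :=
  ∀ x : M, ∃ t : TangentSpace 𝓘(ℝ, E) x, g.inner x t t < 0 ∧
    ∀ w : TangentSpace 𝓘(ℝ, E) x, g.inner x t w = 0 → w ≠ 0 → 0 < g.inner x w w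

/-! ### The Levi-Civita connection -/

/-- The scalar product at `x` as a bilinear form. -/
def SemiRiemannianMetric.bilin (g : SemiRiemannianMetric E M) (x : M) :
    LinearMap.BilinForm ℝ (TangentSpace 𝓘(ℝ, E) x) :=
  LinearMap.mk₂ ℝ (fun v w ↦ g.inner x v w) (by simp) (by simp) (by simp) (by simp)

theorem SemiRiemannianMetric.bilin_nondegenerate (g : SemiRiemannianMetric E M) (x : M) :
    (g.bilin x).Nondegenerate := by
  refine ⟨fun v hv ↦ g.nondegenerate x v hv, fun v hv ↦ g.nondegenerate x v fun w ↦ ?_⟩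
  rw [g.symm]
  exact hv w

theorem SemiRiemannianMetric.bilin_isRefl (g : SemiRiemannianMetric E M) (x : M) :
    (g.bilin x).IsRefl := fun v w h ↦ (g.symm x w v).trans h

instance instFiniteDimensionalTangentSpace (x : M) :
    FiniteDimensional ℝ (TangentSpace 𝓘(ℝ, E) x) :=
  inferInstanceAs (FiniteDimensional ℝ E)

instance instT2SpaceTangentSpace (x : M) : T2Space (TangentSpace 𝓘(ℝ, E) x) :=
  inferInstanceAs (T2Space E)

/-- The metric isomorphism from covectors to vectors. -/
def SemiRiemannianMetric.sharp (g : SemiRiemannianMetric E M) (x : M) :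
    Module.Dual ℝ (TangentSpace 𝓘(ℝ, E) x) ≃ₗ[ℝ] TangentSpace 𝓘(ℝ, E) x :=
  ((g.bilin x).toDual (g.bilin_nondegenerate x)).symm

/-- The components at `y` of the metric in the preferred chart at `x`. -/
def SemiRiemannianMetric.coord (g : SemiRiemannianMetric E M) (x y : M) :
    E →L[ℝ] E →L[ℝ] ℝ :=
  ((ofCoord x y).precomp ℝ).comp ((g.inner y).comp (ofCoord x y))

/-- The derivative at `x` of the components of the metric in the preferred chart at `x`:
`g.dcoord x u v w = ∂ᵤ g(v, w)`. -/
def SemiRiemannianMetric.dcoord (g : SemiRiemannianMetric E M) (x : M)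
    (u v w : TangentSpace 𝓘(ℝ, E) x) : ℝ :=
  mvfderiv 𝓘(ℝ, E) (g.coord x) x u (toCoord x x v) (toCoord x x w)

theorem SemiRiemannianMetric.dcoord_add (g : SemiRiemannianMetric E M) (x : M)
    (u u' v v' w w' : TangentSpace 𝓘(ℝ, E) x) :
    g.dcoord x (u + u') v w = g.dcoord x u v w + g.dcoord x u' v w ∧
    g.dcoord x u (v + v') w = g.dcoord x u v w + g.dcoord x u v' w ∧
    g.dcoord x u v (w + w') = g.dcoord x u v w + g.dcoord x u v w' := by
  unfold dcoord
  refine ⟨?_, ?_, ?_⟩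
  · rw [ContinuousLinearMap.map_add]; rfl
  · rw [ContinuousLinearMap.map_add, ContinuousLinearMap.map_add]; rfl
  · rw [ContinuousLinearMap.map_add, ContinuousLinearMap.map_add]

theorem SemiRiemannianMetric.dcoord_smul (g : SemiRiemannianMetric E M) (x : M) (c : ℝ)
    (u v w : TangentSpace 𝓘(ℝ, E) x) :
    g.dcoord x (c • u) v w = c * g.dcoord x u v w ∧
    g.dcoord x u (c • v) w = c * g.dcoord x u v w ∧
    g.dcoord x u v (c • w) = c * g.dcoord x u v w := by
  unfold dcoord
  refine ⟨?_, ?_, ?_⟩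
  · rw [ContinuousLinearMap.map_smul]; rfl
  · rw [ContinuousLinearMap.map_smul, ContinuousLinearMap.map_smul]; rfl
  · rw [ContinuousLinearMap.map_smul, ContinuousLinearMap.map_smul, smul_eq_mul]

/-- The Christoffel symbols at `x` in the preferred chart at `x`, as the bilinear map `Γ` with
`2 g(Γ(u, v), w) = ∂ᵤ g(v, w) + ∂ᵥ g(u, w) - ∂_w g(u, v)`. -/
def SemiRiemannianMetric.christoffel (g : SemiRiemannianMetric E M) (x : M) :
    TangentSpace 𝓘(ℝ, E) x →ₗ[ℝ] TangentSpace 𝓘(ℝ, E) x →ₗ[ℝ] TangentSpace 𝓘(ℝ, E) x :=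
  LinearMap.mk₂ ℝ
    (fun u v ↦ g.sharp x
      { toFun := fun w ↦ (1 / 2 : ℝ) * (g.dcoord x u v w + g.dcoord x v u w - g.dcoord x w u v)
        map_add' := fun w w' ↦ by
          rw [(g.dcoord_add x u 0 v 0 w w').2.2, (g.dcoord_add x v 0 u 0 w w').2.2,
            (g.dcoord_add x w w' u 0 v 0).1]
          ring
        map_smul' := fun c w ↦ by
          rw [(g.dcoord_smul x c u v w).2.2, (g.dcoord_smul x c v u w).2.2,
            (g.dcoord_smul x c w u v).1, RingHom.id_apply, smul_eq_mul]
          ring })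
    (fun u u' v ↦ by
      rw [← map_add]
      congr 1
      ext w
      simp only [LinearMap.coe_mk, AddHom.coe_mk, LinearMap.add_apply]
      rw [(g.dcoord_add x u u' v 0 w 0).1, (g.dcoord_add x v 0 u u' w 0).2.1,
        (g.dcoord_add x w 0 u u' v 0).2.1]
      ring)
    (fun c u v ↦ by
      rw [← map_smul]
      congr 1
      ext w
      simp only [LinearMap.coe_mk, AddHom.coe_mk, LinearMap.smul_apply, smul_eq_mul]
      rw [(g.dcoord_smul x c u v w).1, (g.dcoord_smul x c v u w).2.1,
        (g.dcoord_smul x c w u v).2.1]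
      ring)
    (fun u v v' ↦ by
      rw [← map_add]
      congr 1
      ext w
      simp only [LinearMap.coe_mk, AddHom.coe_mk, LinearMap.add_apply]
      rw [(g.dcoord_add x u 0 v v' w 0).2.1, (g.dcoord_add x v v' u 0 w 0).1,
        (g.dcoord_add x w 0 u 0 v v').2.2]
      ring)
    (fun c u v ↦ by
      rw [← map_smul]
      congr 1
      ext w
      simp only [LinearMap.coe_mk, AddHom.coe_mk, LinearMap.smul_apply, smul_eq_mul]
      rw [(g.dcoord_smul x c u v w).2.1, (g.dcoord_smul x c v u w).1,
        (g.dcoord_smul x c w u v).2.2]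
      ring)

/-- The Levi-Civita connection of `g`: in the preferred chart at `x`, the vector `∇_X Y` at `x` is
`∂_X Y + Γ(X, Y)`. Its value at `x` is written `g.leviCivita Y x (X x)`. -/
def SemiRiemannianMetric.leviCivita (g : SemiRiemannianMetric E M) :
    CovariantDerivative 𝓘(ℝ, E) E (TangentSpace 𝓘(ℝ, E) : M → Type _) where
  toFun Y x := (ofCoord x x).comp (mvfderiv 𝓘(ℝ, E) (fun y ↦ toCoord x y (Y y)) x) +
    LinearMap.toContinuousLinearMap ((g.christoffel x).flip (Y x))
  isCovariantDerivativeOnUniv :=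
  { add := by
      intro σ σ' x hσ hσ' _
      have h : (fun y ↦ toCoord x y ((σ + σ') y)) =
          (fun y ↦ toCoord x y (σ y)) + (fun y ↦ toCoord x y (σ' y)) := by
        ext y; simp
      rw [h, mvfderiv_add (mdifferentiableAt_toCoord hσ) (mdifferentiableAt_toCoord hσ')]
      ext v
      simp
      abel
    leibniz := by
      intro σ f x hσ hf _
      have h : (fun y ↦ toCoord x y ((f • σ) y)) = f • (fun y ↦ toCoord x y (σ y)) := by
        ext y; simp
      rw [h, mvfderiv_smul hf (mdifferentiableAt_toCoord hσ)]
      ext v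
      simp [ofCoord_toCoord]
      module }


/-! ### Semi-Riemannian submersions -/

/-- The vertical space `ker F_*` at `x`. -/
def vertical (E E' : Type*) [NormedAddCommGroup E] [NormedSpace ℝ E]
    [NormedAddCommGroup E'] [NormedSpace ℝ E'] {M N : Type*} [TopologicalSpace M]
    [ChartedSpace E M] [TopologicalSpace N] [ChartedSpace E' N] (F : M → N) (x : M) :
    Submodule ℝ (TangentSpace 𝓘(ℝ, E) x) :=
  LinearMap.ker (mfderiv 𝓘(ℝ, E) 𝓘(ℝ, E') F x).toLinearMap

/-- The horizontal space `(ker F_*)^⊥` at `x`. -/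
def horizontal (E' : Type*) [NormedAddCommGroup E'] [NormedSpace ℝ E'] {N : Type*}
    [TopologicalSpace N] [ChartedSpace E' N] (gM : SemiRiemannianMetric E M) (F : M → N) (x : M) :
    Submodule ℝ (TangentSpace 𝓘(ℝ, E) x) :=
  (gM.bilin x).orthogonal (vertical E E' F x)

/-- `F` is a semi-Riemannian submersion of `(M, gM)` onto `(N, gN)`: a smooth surjective submersion
whose fibres are semi-Riemannian submanifolds and whose differential preserves scalar products of
vectors normal to the fibres. -/
structure IsSemiRiemannianSubmersion (gM : SemiRiemannianMetric E M)
    (gN : SemiRiemannianMetric E' N) (F : M → N) : Prop where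
  contMDiff : ContMDiff 𝓘(ℝ, E) 𝓘(ℝ, E') ∞ F
  surjective : Function.Surjective F
  submersion (x : M) : Function.Surjective (mfderiv 𝓘(ℝ, E) 𝓘(ℝ, E') F x)
  /-- The metric induced on the fibre through `x` is nondegenerate. -/
  fibre_nondegenerate (x : M) (v : TangentSpace 𝓘(ℝ, E) x) (hv : v ∈ vertical E E' F x)
    (h : ∀ w ∈ vertical E E' F x, gM.inner x v w = 0) : v = 0
  isometry (x : M) (v w : TangentSpace 𝓘(ℝ, E) x)
    (hv : v ∈ horizontal E' gM F x) (hw : w ∈ horizontal E' gM F x) :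
    gN.inner (F x) (mfderiv 𝓘(ℝ, E) 𝓘(ℝ, E') F x v) (mfderiv 𝓘(ℝ, E) 𝓘(ℝ, E') F x w) =
      gM.inner x v w

/-- The connection on `F^* TN` induced by the Levi-Civita connection of `gN`: for a section `s`
along `F`, in the preferred chart of `N` at `F x`, the vector `∇^F_v s` is
`∂_v s + Γ(F_* v, s)`. -/
def pullbackCov (gN : SemiRiemannianMetric E' N) (F : M → N)
    (s : ∀ x : M, TangentSpace 𝓘(ℝ, E') (F x)) (x : M) (v : TangentSpace 𝓘(ℝ, E) x) :
    TangentSpace 𝓘(ℝ, E') (F x) :=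
  ofCoord (F x) (F x) (mvfderiv 𝓘(ℝ, E) (fun y ↦ toCoord (F x) (F y) (s y)) x v) +
    gN.christoffel (F x) (mfderiv 𝓘(ℝ, E) 𝓘(ℝ, E') F x v) (s x)

/-- The second fundamental form of the map `F`:
`(∇F_*)(X, Y) = ∇^F_X (F_* Y) - F_* (∇_X Y)`. -/
def secondFundamentalForm (gM : SemiRiemannianMetric E M) (gN : SemiRiemannianMetric E' N)
    (F : M → N) (X Y : ∀ x : M, TangentSpace 𝓘(ℝ, E) x) (x : M) :
    TangentSpace 𝓘(ℝ, E') (F x) :=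
  pullbackCov gN F (fun y ↦ mfderiv 𝓘(ℝ, E) 𝓘(ℝ, E') F y (Y y)) x (X x) -
    mfderiv 𝓘(ℝ, E) 𝓘(ℝ, E') F x (gM.leviCivita Y x (X x))

/-- `V` is a smooth section of `ker F_*`. -/
def IsVerticalField (E' : Type*) [NormedAddCommGroup E'] [NormedSpace ℝ E'] {N : Type*}
    [TopologicalSpace N] [ChartedSpace E' N] (F : M → N)
    (V : ∀ x : M, TangentSpace 𝓘(ℝ, E) x) : Prop :=
  IsSmoothField V ∧ ∀ x, V x ∈ vertical E E' F x

/-- `X` is a smooth section of `(ker F_*)^⊥`. -/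
def IsHorizontalField (E' : Type*) [NormedAddCommGroup E'] [NormedSpace ℝ E'] {N : Type*}
    [TopologicalSpace N] [ChartedSpace E' N] (gM : SemiRiemannianMetric E M) (F : M → N)
    (X : ∀ x : M, TangentSpace 𝓘(ℝ, E) x) : Prop :=
  IsSmoothField X ∧ ∀ x, X x ∈ horizontal E' gM F x

/-- The distribution `D` defines a totally geodesic foliation: it is integrable (closed under the
Lie bracket), and the second fundamental form of its leaves, that is, the component of `∇_V W`
normal to `D` for sections `V`, `W` of `D`, vanishes. -/
def IsTotallyGeodesicFoliation (g : SemiRiemannianMetric E M)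
    (D : ∀ x : M, Submodule ℝ (TangentSpace 𝓘(ℝ, E) x)) : Prop :=
  ∀ V W : ∀ x : M, TangentSpace 𝓘(ℝ, E) x, IsSmoothField V → IsSmoothField W →
    (∀ x, V x ∈ D x) → (∀ x, W x ∈ D x) →
    ∀ x, VectorField.mlieBracket 𝓘(ℝ, E) V W x ∈ D x ∧ g.leviCivita W x (V x) ∈ D x

namespace IsSemiRiemannianSubmersion

variable {gM : SemiRiemannianMetric E M} {gN : SemiRiemannianMetric E' N} {F : M → N}

theorem isCompl (hF : IsSemiRiemannianSubmersion gM gN F) (x : M) :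
    IsCompl (vertical E E' F x) (horizontal E' gM F x) := by
  refine (LinearMap.BilinForm.isCompl_orthogonal_iff_disjoint (gM.bilin_isRefl x)).2 ?_
  rw [Submodule.disjoint_def]
  intro v hv hv'
  refine hF.fibre_nondegenerate x v hv fun w hw ↦ ?_
  rw [gM.symm]
  exact hv' w hw

/-- The projection `𝒱` of the tangent space onto the vertical space, along the horizontal one. -/
def verticalPart (hF : IsSemiRiemannianSubmersion gM gN F) (x : M) :
    TangentSpace 𝓘(ℝ, E) x →ₗ[ℝ] TangentSpace 𝓘(ℝ, E) x :=
  (vertical E E' F x).projection (horizontal E' gM F x) (hF.isCompl x)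

/-- The projection `ℋ` of the tangent space onto the horizontal space, along the vertical one. -/
def horizontalPart (hF : IsSemiRiemannianSubmersion gM gN F) (x : M) :
    TangentSpace 𝓘(ℝ, E) x →ₗ[ℝ] TangentSpace 𝓘(ℝ, E) x :=
  (horizontal E' gM F x).projection (vertical E E' F x) (hF.isCompl x).symm

/-- O'Neill's tensor `𝒯_X Y = ℋ ∇_{𝒱X} 𝒱Y + 𝒱 ∇_{𝒱X} ℋY`. -/
def tensorT (hF : IsSemiRiemannianSubmersion gM gN F)
    (X Y : ∀ x : M, TangentSpace 𝓘(ℝ, E) x) (x : M) : TangentSpace 𝓘(ℝ, E) x :=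
  hF.horizontalPart x
      (gM.leviCivita (fun y ↦ hF.verticalPart y (Y y)) x (hF.verticalPart x (X x))) +
    hF.verticalPart x
      (gM.leviCivita (fun y ↦ hF.horizontalPart y (Y y)) x (hF.verticalPart x (X x)))

/-- O'Neill's tensor `𝒜_X Y = 𝒱 ∇_{ℋX} ℋY + ℋ ∇_{ℋX} 𝒱Y`. -/
def tensorA (hF : IsSemiRiemannianSubmersion gM gN F)
    (X Y : ∀ x : M, TangentSpace 𝓘(ℝ, E) x) (x : M) : TangentSpace 𝓘(ℝ, E) x :=
  hF.verticalPart x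
      (gM.leviCivita (fun y ↦ hF.horizontalPart y (Y y)) x (hF.horizontalPart x (X x))) +
    hF.horizontalPart x
      (gM.leviCivita (fun y ↦ hF.verticalPart y (Y y)) x (hF.horizontalPart x (X x)))

end IsSemiRiemannianSubmersion

/-! ### Lorentzian (para)Sasakian structures -/

/-- A structure `(φ, ξ, η)` making the odd-dimensional manifold `(M, g)` a Lorentzian almost contact
manifold (for `ε = -1`) or a Lorentzian almost paracontact manifold (for `ε = 1`). -/
structure LorentzianAlmostContact (g : SemiRiemannianMetric E M) (ε : ℝ) where
  lorentzian : g.IsLorentzian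
  odd_finrank : Odd (Module.finrank ℝ E)
  /-- The `(1, 1)`-tensor field `φ`. -/
  phi (x : M) : TangentSpace 𝓘(ℝ, E) x →L[ℝ] TangentSpace 𝓘(ℝ, E) x
  /-- The characteristic vector field `ξ`. -/
  xi (x : M) : TangentSpace 𝓘(ℝ, E) x
  /-- The 1-form `η`. -/
  eta (x : M) : TangentSpace 𝓘(ℝ, E) x →L[ℝ] ℝ
  phi_contMDiff : ContMDiff 𝓘(ℝ, E) (𝓘(ℝ, E).prod 𝓘(ℝ, E →L[ℝ] E)) ∞
    (fun x ↦ TotalSpace.mk' (E →L[ℝ] E)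
      (E := fun y : M ↦ TangentSpace 𝓘(ℝ, E) y →L[ℝ] TangentSpace 𝓘(ℝ, E) y) x (phi x))
  xi_smooth : IsSmoothField xi
  eta_contMDiff : ContMDiff 𝓘(ℝ, E) (𝓘(ℝ, E).prod 𝓘(ℝ, E →L[ℝ] ℝ)) ∞
    (fun x ↦ TotalSpace.mk' (E →L[ℝ] ℝ)
      (E := fun y : M ↦ TangentSpace 𝓘(ℝ, E) y →L[ℝ] ℝ) x (eta x))
  phi_phi (x : M) (v : TangentSpace 𝓘(ℝ, E) x) : phi x (phi x v) = ε • v + eta x v • xi x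
  inner_phi_phi (x : M) (v w : TangentSpace 𝓘(ℝ, E) x) :
    g.inner x (phi x v) (phi x w) = g.inner x v w + eta x v * eta x w
  eta_eq (x : M) (v : TangentSpace 𝓘(ℝ, E) x) : eta x v = ε * g.inner x v (xi x)
  eta_xi (x : M) : eta x (xi x) = -ε

namespace LorentzianAlmostContact

variable {g : SemiRiemannianMetric E M} {gN : SemiRiemannianMetric E' N} {ε : ℝ} {F : M → N}

/-- The structure is Lorentzian Sasakian (for `ε = -1`) or Lorentzian para Sasakian (for `ε = 1`):
`(∇_X φ) Y = ε g(φX, φY) ξ + η(Y) φ² X`, where `(∇_X φ) Y = ∇_X (φY) - φ (∇_X Y)`. -/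
def IsSasakian (S : LorentzianAlmostContact g ε) : Prop :=
  ∀ X Y : ∀ x : M, TangentSpace 𝓘(ℝ, E) x, IsSmoothField X → IsSmoothField Y → ∀ x,
    g.leviCivita (fun y ↦ S.phi y (Y y)) x (X x) - S.phi x (g.leviCivita Y x (X x)) =
      (ε * g.inner x (S.phi x (X x)) (S.phi x (Y x))) • S.xi x +
        S.eta x (Y x) • S.phi x (S.phi x (X x))

/-- `F` is anti-invariant: `φ (ker F_*) ⊆ (ker F_*)^⊥`. -/
def IsAntiInvariant (E' : Type*) [NormedAddCommGroup E'] [NormedSpace ℝ E'] {N : Type*}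
    [TopologicalSpace N] [ChartedSpace E' N] (S : LorentzianAlmostContact g ε) (F : M → N) : Prop :=
  ∀ x, ∀ v ∈ vertical E E' F x, S.phi x v ∈ horizontal E' g F x

/-- The orthogonal complement `μ` of `φ (ker F_*)` in `(ker F_*)^⊥` at `x`. -/
def mu (E' : Type*) [NormedAddCommGroup E'] [NormedSpace ℝ E'] {N : Type*}
    [TopologicalSpace N] [ChartedSpace E' N] (S : LorentzianAlmostContact g ε) (F : M → N) (x : M) :
    Submodule ℝ (TangentSpace 𝓘(ℝ, E) x) :=
  horizontal E' g F x ⊓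
    (g.bilin x).orthogonal ((vertical E E' F x).map (S.phi x).toLinearMap)

/-- `BX`: the vertical part of `φX`. -/
def fieldB (S : LorentzianAlmostContact g ε) (hF : IsSemiRiemannianSubmersion g gN F)
    (X : ∀ x : M, TangentSpace 𝓘(ℝ, E) x) (x : M) : TangentSpace 𝓘(ℝ, E) x :=
  hF.verticalPart x (S.phi x (X x))

/-- `CX`: the horizontal part of `φX`, so that `φX = BX + CX`. For horizontal `X` and an
anti-invariant `F` with `ξ` horizontal, it lies in `μ` (see `fieldC_mem_mu`). -/
def fieldC (S : LorentzianAlmostContact g ε) (hF : IsSemiRiemannianSubmersion g gN F)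
    (X : ∀ x : M, TangentSpace 𝓘(ℝ, E) x) (x : M) : TangentSpace 𝓘(ℝ, E) x :=
  hF.horizontalPart x (S.phi x (X x))

theorem fieldB_add_fieldC (S : LorentzianAlmostContact g ε)
    (hF : IsSemiRiemannianSubmersion g gN F) (X : ∀ x : M, TangentSpace 𝓘(ℝ, E) x) (x : M) :
    S.fieldB hF X x + S.fieldC hF X x = S.phi x (X x) := by
  unfold fieldB fieldC IsSemiRiemannianSubmersion.verticalPart
    IsSemiRiemannianSubmersion.horizontalPart
  exact Submodule.projection_add_projection_eq_self (hF.isCompl x) _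

theorem fieldC_mem_mu (S : LorentzianAlmostContact g ε)
    (hF : IsSemiRiemannianSubmersion g gN F) (hanti : S.IsAntiInvariant E' F)
    (hxi : ∀ x, S.xi x ∈ horizontal E' g F x) (X : ∀ x : M, TangentSpace 𝓘(ℝ, E) x) (x : M)
    (hX : X x ∈ horizontal E' g F x) : S.fieldC hF X x ∈ S.mu E' F x := by
  refine ⟨Submodule.projection_apply_mem _ _, ?_⟩
  rintro _ ⟨v, hv, rfl⟩
  have hB : S.fieldB hF X x ∈ vertical E E' F x := Submodule.projection_apply_mem _ _
  have hC : S.fieldC hF X x = S.phi x (X x) - S.fieldB hF X x :=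
    eq_sub_of_add_eq' (S.fieldB_add_fieldC hF X x)
  have h1 : g.inner x (S.phi x v) (S.fieldB hF X x) = 0 := by
    rw [g.symm]; exact hanti x v hv _ hB
  have h2 : g.inner x v (X x) = 0 := hX v hv
  have h3 : g.inner x v (S.xi x) = 0 := hxi x v hv
  change g.inner x (S.phi x v) (S.fieldC hF X x) = 0
  rw [hC, map_sub, h1, S.inner_phi_phi, h2, S.eta_eq x v, h3]
  ring

end LorentzianAlmostContact

end SemiRiem

end

/-! All three conditions are compared with one condition P: g(∇_{φX} V, φW) = 0 for X horizontal and
V, W vertical. The second fundamental form of `F` is symmetric and F_*V = 0, so (∇F_*)(V, φX) =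
-F_*(∇_{φX} V); since `F` is isometric against the horizontal vector φW, this turns (b) into P.
Since [V, BX] is vertical, 𝒯_V BX + 𝒜_{CX} V is the horizontal part of ∇_{φX} V, which turns (c)
into P. It remains to compare (a) with P.

For ε = 1 the vertical spaces vanish (`IsSasakian.vertical_eq_zero`). Alternation of 𝒜
(`inner_leviCivita_vertical`) gives g(∇_ξ V, φW) = g(V, W), symmetric in V and W, while
differentiating g(V, φW) = 0 shows that the left side is antisymmetric. Hence g(V, W) = 0 on the
nondegenerate fibres.

For ε = -1 the horizontal space is spanned by φ(ker F_*), by ξ and by the part of μ orthogonal to ξ.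
The first two directions are quick; the last one carries the difficulty. For Y in that part of μ put
α(Y) = g(∇_Y V, φW) and τ(Y) = g(∇_V W, Y): P controls α, total geodesy controls τ, and the two must
be linked. The link is differentiation along ξ, which is Killing and preserves φ, with [ξ, V] = DV +
2φV for a vertical field DV. Consider k(Y) = g(V, [Y, φW]) = -2α(Y) and l(Y) = g([V, Y], φW) = τ(φY)
- α(Y). Up to terms of the same shape, with one of V, W, Y replaced by DV, DW, [ξ, Y], the
derivative of k is 2(α(φY) - τ(Y)) and that of l is -2(α(φY) - τ(Y)). If α = 0, then k = 0, and its
derivative gives τ = 0. If τ = 0, then k = 2l, and comparing derivatives gives 2α(φY) = -4α(φY), so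
α = 0 because φ² = -1 on this part of μ. -/

set_option linter.unusedSectionVars false

noncomputable section

namespace SemiRiem
open Filter Topology

/-! ### The Lie bracket as the commutator of derivations -/

section Bracket
variable {E : Type*} [NormedAddCommGroup E] [NormedSpace ℝ E]
  {M : Type*} [TopologicalSpace M] [ChartedSpace E M] [IsManifold 𝓘(ℝ, E) ∞ M]
  {G : Type*} [NormedAddCommGroup G] [NormedSpace ℝ G]

theorem mvfderiv_eq_fderiv_comp_extChartAt {h : M → G} {x y : M}
    (hh : MDifferentiableAt 𝓘(ℝ, E) 𝓘(ℝ, G) h y) (hy : y ∈ (extChartAt 𝓘(ℝ, E) x).source)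
    (v : TangentSpace 𝓘(ℝ, E) y) :
    mvfderiv 𝓘(ℝ, E) h y v = fderiv ℝ (h ∘ (extChartAt 𝓘(ℝ, E) x).symm) (extChartAt 𝓘(ℝ, E) x y)
      (mfderiv 𝓘(ℝ, E) 𝓘(ℝ, E) (extChartAt 𝓘(ℝ, E) x) y v) := by
  have hl : (extChartAt 𝓘(ℝ, E) x).symm (extChartAt 𝓘(ℝ, E) x y) = y :=
    (extChartAt 𝓘(ℝ, E) x).left_inv hy
  have h1 : MDifferentiableAt 𝓘(ℝ, E) 𝓘(ℝ, E) (extChartAt 𝓘(ℝ, E) x) y :=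
    mdifferentiableAt_extChartAt (by simpa using hy)
  have h2 : MDifferentiableAt 𝓘(ℝ, E) 𝓘(ℝ, E) (extChartAt 𝓘(ℝ, E) x).symm
      (extChartAt 𝓘(ℝ, E) x y) :=
    (mdifferentiableOn_extChartAt_symm _ ((extChartAt 𝓘(ℝ, E) x).map_source hy)).mdifferentiableAt
      ((isOpen_extChartAt_target x).mem_nhds ((extChartAt 𝓘(ℝ, E) x).map_source hy))
  have h3 : MDifferentiableAt 𝓘(ℝ, E) 𝓘(ℝ, G) (h ∘ (extChartAt 𝓘(ℝ, E) x).symm)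
      (extChartAt 𝓘(ℝ, E) x y) := by
    refine MDifferentiableAt.comp _ ?_ h2
    rwa [hl]
  have heq : h =ᶠ[𝓝 y] (h ∘ (extChartAt 𝓘(ℝ, E) x).symm) ∘ extChartAt 𝓘(ℝ, E) x := by
    filter_upwards [(isOpen_extChartAt_source (I := 𝓘(ℝ, E)) x).mem_nhds hy] with z hz
    simp only [Function.comp_apply]
    rw [(extChartAt 𝓘(ℝ, E) x).left_inv hz]
  have key := mfderiv_comp y h3 h1
  rw [← mfderiv_eq_fderiv]
  have := heq.mfderiv_eq (I := 𝓘(ℝ, E)) (I' := 𝓘(ℝ, G))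
  change mfderiv 𝓘(ℝ, E) 𝓘(ℝ, G) h y v = _
  rw [this, key]
  rfl

theorem mpullbackWithin_extChartAt_symm_apply (X : ∀ x : M, TangentSpace 𝓘(ℝ, E) x) (x : M) :
    ∀ᶠ y in 𝓝 x, VectorField.mpullbackWithin 𝓘(ℝ, E) 𝓘(ℝ, E) (extChartAt 𝓘(ℝ, E) x).symm X
      (range 𝓘(ℝ, E)) (extChartAt 𝓘(ℝ, E) x y) =
      mfderiv 𝓘(ℝ, E) 𝓘(ℝ, E) (extChartAt 𝓘(ℝ, E) x) y (X y) := by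
  have := VectorField.eventuallyEq_mpullback_mpullbackWithin_extChartAt (I := 𝓘(ℝ, E)) (s := univ)
    (x := x) X
  rw [nhdsWithin_univ] at this
  filter_upwards [this, extChartAt_source_mem_nhds (I := 𝓘(ℝ, E)) x] with y hy hy'
  conv_rhs => rw [hy]
  rw [VectorField.mpullback_apply]
  exact (((isInvertible_mfderiv_extChartAt hy').inverse_apply_eq).1 rfl)

theorem mvfderiv_mlieBracket [CompleteSpace E] {h : M → G}
    {X Y : ∀ x : M, TangentSpace 𝓘(ℝ, E) x}
    {x : M} (hh : ContMDiffAt 𝓘(ℝ, E) 𝓘(ℝ, G) ∞ h x)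
    (hX : MDiffAt (T% X) x) (hY : MDiffAt (T% Y) x) :
    mvfderiv 𝓘(ℝ, E) h x (VectorField.mlieBracket 𝓘(ℝ, E) X Y x) =
      mvfderiv 𝓘(ℝ, E) (fun y ↦ mvfderiv 𝓘(ℝ, E) h y (Y y)) x (X x) -
      mvfderiv 𝓘(ℝ, E) (fun y ↦ mvfderiv 𝓘(ℝ, E) h y (X y)) x (Y x) := by
  have hx := mem_extChartAt_source (I := 𝓘(ℝ, E)) x
  set f : E → G := h ∘ (extChartAt 𝓘(ℝ, E) x).symm with hf
  set p : E := extChartAt 𝓘(ℝ, E) x x with hp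
  have hfp : ContDiffAt ℝ ∞ f p := by
    rw [← contMDiffAt_iff_contDiffAt]
    refine ContMDiffAt.comp _ ?_ ((contMDiffOn_extChartAt_symm x).contMDiffAt
      ((isOpen_extChartAt_target x).mem_nhds (mem_extChartAt_target x)))
    rwa [(extChartAt 𝓘(ℝ, E) x).left_inv hx]
  have hh1 : ∀ᶠ y in 𝓝 x, MDifferentiableAt 𝓘(ℝ, E) 𝓘(ℝ, G) h y := by
    have : ContMDiffAt 𝓘(ℝ, E) 𝓘(ℝ, G) 1 h x := hh.of_le (by simp)
    filter_upwards [(contMDiffAt_iff_contMDiffAt_nhds (by simp)).1 this] with y hy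
    exact hy.mdifferentiableAt one_ne_zero
  have hd : ∀ Z : ∀ x : M, TangentSpace 𝓘(ℝ, E) x, MDiffAt (T% Z) x → DifferentiableAt ℝ
      (VectorField.mpullbackWithin 𝓘(ℝ, E) 𝓘(ℝ, E) (extChartAt 𝓘(ℝ, E) x).symm Z
        (range 𝓘(ℝ, E))) p := by
    intro Z hZ
    have := MDifferentiableWithinAt.differentiableWithinAt_mpullbackWithin_vectorField (s := univ)
      hZ.mdifferentiableWithinAt
    refine DifferentiableWithinAt.differentiableAt (s := univ) ?_ univ_mem
    convert this using 1
    simp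
  have hder : ∀ Z : ∀ x : M, TangentSpace 𝓘(ℝ, E) x, MDiffAt (T% Z) x →
      ∀ v : TangentSpace 𝓘(ℝ, E) x, mvfderiv 𝓘(ℝ, E) (fun y ↦ mvfderiv 𝓘(ℝ, E) h y (Z y)) x v =
        fderiv ℝ (fun z ↦ fderiv ℝ f z (VectorField.mpullbackWithin 𝓘(ℝ, E) 𝓘(ℝ, E)
          (extChartAt 𝓘(ℝ, E) x).symm Z (range 𝓘(ℝ, E)) z)) p
          (mfderiv 𝓘(ℝ, E) 𝓘(ℝ, E) (extChartAt 𝓘(ℝ, E) x) x v) := by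
    intro Z hZ v
    set Zt : E → E := VectorField.mpullbackWithin 𝓘(ℝ, E) 𝓘(ℝ, E)
          (extChartAt 𝓘(ℝ, E) x).symm Z (range 𝓘(ℝ, E)) with hZt
    have e1 : (fun y ↦ mvfderiv 𝓘(ℝ, E) h y (Z y)) =ᶠ[𝓝 x]
        (fun z ↦ fderiv ℝ f z (Zt z)) ∘ extChartAt 𝓘(ℝ, E) x := by
      filter_upwards [hh1, extChartAt_source_mem_nhds (I := 𝓘(ℝ, E)) x,
        mpullbackWithin_extChartAt_symm_apply Z x] with y hy hy' hy''
      rw [mvfderiv_eq_fderiv_comp_extChartAt hy hy' (Z y), ← hy'']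
      rfl
    have e2 : DifferentiableAt ℝ (fun z ↦ fderiv ℝ f z (Zt z)) p := by
      refine DifferentiableAt.clm_apply ?_ (hd Z hZ)
      exact (hfp.fderiv_right (m := 1) (by norm_cast)).differentiableAt one_ne_zero
    have e3 := mfderiv_comp (f := extChartAt 𝓘(ℝ, E) x) x e2.mdifferentiableAt
      (mdifferentiableAt_extChartAt (I := 𝓘(ℝ, E)) (mem_chart_source E x))
    rw [mfderiv_eq_fderiv] at e3
    exact congrArg (fun L : E →L[ℝ] G ↦ L v) (e1.mfderiv_eq.trans e3)
  rw [hder X hX, hder Y hY, mvfderiv_eq_fderiv_comp_extChartAt hh1.self_of_nhds hx]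
  have e4 : mfderiv 𝓘(ℝ, E) 𝓘(ℝ, E) (extChartAt 𝓘(ℝ, E) x) x
      (VectorField.mlieBracket 𝓘(ℝ, E) X Y x) = VectorField.lieBracket ℝ
      (VectorField.mpullbackWithin 𝓘(ℝ, E) 𝓘(ℝ, E) (extChartAt 𝓘(ℝ, E) x).symm X (range 𝓘(ℝ, E)))
      (VectorField.mpullbackWithin 𝓘(ℝ, E) 𝓘(ℝ, E) (extChartAt 𝓘(ℝ, E) x).symm Y (range 𝓘(ℝ, E)))
      p := by
    rw [← VectorField.mlieBracketWithin_univ, VectorField.mlieBracketWithin_apply]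
    refine (((isInvertible_mfderiv_extChartAt hx).inverse_apply_eq).1 rfl).symm.trans ?_
    rw [preimage_univ, univ_inter, ModelWithCorners.range_eq_univ]
    exact congrFun (VectorField.lieBracketWithin_univ (E := E)) _
  rw [e4, ← (mpullbackWithin_extChartAt_symm_apply X x).self_of_nhds,
    ← (mpullbackWithin_extChartAt_symm_apply Y x).self_of_nhds]
  -- In the chart the identity is the symmetry of the second derivative of `f`.
  exact VectorField.fderiv_apply_lieBracket hfp
    (by simpa using ENat.LEInfty.out) (hd Y hY) (hd X hX)

end Bracket

/-! ### Tangent coordinates in a fixed chart -/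

section Coord
variable {E : Type*} [NormedAddCommGroup E] [NormedSpace ℝ E]
  {M : Type*} [TopologicalSpace M] [ChartedSpace E M] [IsManifold 𝓘(ℝ, E) ∞ M]

theorem mem_baseSet_tangent_nhds (x : M) :
    (trivializationAt E (TangentSpace 𝓘(ℝ, E)) x).baseSet ∈ 𝓝 x :=
  (trivializationAt E (TangentSpace 𝓘(ℝ, E)) x).open_baseSet.mem_nhds
    (mem_baseSet_trivializationAt E (TangentSpace 𝓘(ℝ, E)) x)

theorem toCoord_apply_of_mem {x y : M}
    (hy : y ∈ (trivializationAt E (TangentSpace 𝓘(ℝ, E)) x).baseSet) (v : TangentSpace 𝓘(ℝ, E) y) :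
    toCoord x y v = (trivializationAt E (TangentSpace 𝓘(ℝ, E)) x ⟨y, v⟩).2 :=
  Trivialization.continuousLinearMapAt_apply_of_mem ℝ _ hy _

theorem ofCoord_toCoord_of_mem {x y : M}
    (hy : y ∈ (trivializationAt E (TangentSpace 𝓘(ℝ, E)) x).baseSet) (v : TangentSpace 𝓘(ℝ, E) y) :
    ofCoord x y (toCoord x y v) = v :=
  Trivialization.symmL_continuousLinearMapAt _ hy v

theorem toCoord_ofCoord_of_mem {x y : M}
    (hy : y ∈ (trivializationAt E (TangentSpace 𝓘(ℝ, E)) x).baseSet) (v : E) :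
    toCoord x y (ofCoord x y v) = v :=
  Trivialization.continuousLinearMapAt_symmL _ hy v

theorem contMDiffAt_section_iff_toCoord {X : ∀ x : M, TangentSpace 𝓘(ℝ, E) x} {x : M} :
    ContMDiffAt 𝓘(ℝ, E) (𝓘(ℝ, E).prod 𝓘(ℝ, E)) ∞ (fun y ↦ TotalSpace.mk' E y (X y)) x ↔
      ContMDiffAt 𝓘(ℝ, E) 𝓘(ℝ, E) ∞ (fun y ↦ toCoord x y (X y)) x := by
  rw [contMDiffAt_section]
  have : (fun y ↦ (trivializationAt E (TangentSpace 𝓘(ℝ, E)) x ⟨y, X y⟩).2) =ᶠ[𝓝 x]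
      (fun y ↦ toCoord x y (X y)) := by
    filter_upwards [mem_baseSet_tangent_nhds (E := E) x] with y hy
    rw [toCoord_apply_of_mem hy]
  exact ⟨fun h ↦ h.congr_of_eventuallyEq this.symm, fun h ↦ h.congr_of_eventuallyEq this⟩

theorem contMDiffAt_ofCoord (x : M) (e : E) :
    ContMDiffAt 𝓘(ℝ, E) (𝓘(ℝ, E).prod 𝓘(ℝ, E)) ∞ (fun y ↦ TotalSpace.mk' E y (ofCoord x y e))
      x := by
  rw [contMDiffAt_section_iff_toCoord]
  refine (contMDiffAt_const (c := e)).congr_of_eventuallyEq ?_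
  filter_upwards [mem_baseSet_tangent_nhds (E := E) x] with y hy
  rw [toCoord_ofCoord_of_mem hy]

theorem toCoord_eq_mvfderiv {x y : M}
    (hy : y ∈ (trivializationAt E (TangentSpace 𝓘(ℝ, E)) x).baseSet) (v : TangentSpace 𝓘(ℝ, E) y) :
    toCoord x y v = mfderiv 𝓘(ℝ, E) 𝓘(ℝ, E) (extChartAt 𝓘(ℝ, E) x) y v := by
  rw [toCoord, TangentBundle.continuousLinearMapAt_trivializationAt
    (by simpa using hy)]
  rfl

end Coord

/-! ### Derivatives along a map -/

section Map
variable {E : Type*} [NormedAddCommGroup E] [NormedSpace ℝ E]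
  {M : Type*} [TopologicalSpace M] [ChartedSpace E M]
  {E' : Type*} [NormedAddCommGroup E'] [NormedSpace ℝ E']
  {N : Type*} [TopologicalSpace N] [ChartedSpace E' N]

theorem mvfderiv_comp_mfderiv {G : Type*} [NormedAddCommGroup G] [NormedSpace ℝ G] {h : N → G}
    {F : M → N} {x : M} (hh : MDifferentiableAt 𝓘(ℝ, E') 𝓘(ℝ, G) h (F x))
    (hF : MDifferentiableAt 𝓘(ℝ, E) 𝓘(ℝ, E') F x) (v : TangentSpace 𝓘(ℝ, E) x) :
    mvfderiv 𝓘(ℝ, E) (fun y ↦ h (F y)) x v =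
      mvfderiv 𝓘(ℝ, E') h (F x) (mfderiv 𝓘(ℝ, E) 𝓘(ℝ, E') F x v) :=
  congrArg (fun T : E →L[ℝ] G ↦ T v) (mfderiv_comp x hh hF)

theorem _root_.Filter.EventuallyEq.mvfderiv_apply_eq {G : Type*} [NormedAddCommGroup G]
    [NormedSpace ℝ G] {f h : M → G} {x : M} (hfh : f =ᶠ[𝓝 x] h) (v : TangentSpace 𝓘(ℝ, E) x) :
    mvfderiv 𝓘(ℝ, E) f x v = mvfderiv 𝓘(ℝ, E) h x v :=
  congrArg (fun T : E →L[ℝ] G ↦ T v) hfh.mfderiv_eq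

theorem contMDiffAt_extChartAt_comp {F : M → N} (hF : ContMDiff 𝓘(ℝ, E) 𝓘(ℝ, E') ∞ F) (x : M) :
    ContMDiffAt 𝓘(ℝ, E) 𝓘(ℝ, E') ∞ (fun z ↦ extChartAt 𝓘(ℝ, E') (F x) (F z)) x :=
  ContMDiffAt.comp x contMDiffAt_extChartAt hF.contMDiffAt

theorem mvfderiv_clm_apply {A B : Type*} [NormedAddCommGroup A] [NormedSpace ℝ A]
    [NormedAddCommGroup B] [NormedSpace ℝ B] {L : M → A →L[ℝ] B} {a : M → A} {x : M}
    (hL : MDifferentiableAt 𝓘(ℝ, E) 𝓘(ℝ, A →L[ℝ] B) L x)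
    (ha : MDifferentiableAt 𝓘(ℝ, E) 𝓘(ℝ, A) a x) (v : TangentSpace 𝓘(ℝ, E) x) :
    MDifferentiableAt 𝓘(ℝ, E) 𝓘(ℝ, B) (fun y ↦ L y (a y)) x ∧
    mvfderiv 𝓘(ℝ, E) (fun y ↦ L y (a y)) x v =
      mvfderiv 𝓘(ℝ, E) L x v (a x) + L x (mvfderiv 𝓘(ℝ, E) a x v) := by
  let a' : E →L[ℝ] A := mvfderiv 𝓘(ℝ, E) a x
  let L' : E →L[ℝ] A →L[ℝ] B := mvfderiv 𝓘(ℝ, E) L x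
  have h : HasMFDerivAt 𝓘(ℝ, E) 𝓘(ℝ, B) (fun y ↦ L y (a y)) x
      (((L x).comp a' + L'.flip (a x) : E →L[ℝ] B)) := by
    refine ⟨hL.continuousAt.clm_apply ha.continuousAt, ?_⟩
    have h' := hL.hasMFDerivAt.2.clm_apply ha.hasMFDerivAt.2
    simp only [writtenInExtChartAt, Function.comp_apply, extChartAt_to_inv] at h'
    exact h'
  refine ⟨h.mdifferentiableAt, ?_⟩
  refine (congrArg (fun T : E →L[ℝ] B ↦ T v) h.mfderiv).trans ?_
  exact add_comm _ _

variable [IsManifold 𝓘(ℝ, E') ∞ N]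

/-- The differential of `F`, read in the preferred chart of `N` at `F x`. -/
theorem toCoord_mfderiv {F : M → N} (hF : ContMDiff 𝓘(ℝ, E) 𝓘(ℝ, E') ∞ F) {x y : M}
    (hy : F y ∈ (trivializationAt E' (TangentSpace 𝓘(ℝ, E')) (F x)).baseSet)
    (v : TangentSpace 𝓘(ℝ, E) y) :
    toCoord (F x) (F y) (mfderiv 𝓘(ℝ, E) 𝓘(ℝ, E') F y v) =
      mvfderiv 𝓘(ℝ, E) (fun z ↦ extChartAt 𝓘(ℝ, E') (F x) (F z)) y v := by
  rw [toCoord_eq_mvfderiv hy]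
  have h1 : MDifferentiableAt 𝓘(ℝ, E') 𝓘(ℝ, E') (extChartAt 𝓘(ℝ, E') (F x)) (F y) :=
    mdifferentiableAt_extChartAt (by simpa using hy)
  exact (congrArg (fun L : E →L[ℝ] E' ↦ L v)
    (mfderiv_comp y h1 (hF.mdifferentiableAt (by simp)))).symm

theorem eventually_mem_baseSet_comp {F : M → N} (hF : ContMDiff 𝓘(ℝ, E) 𝓘(ℝ, E') ∞ F) (x : M) :
    ∀ᶠ y in 𝓝 x, F y ∈ (trivializationAt E' (TangentSpace 𝓘(ℝ, E')) (F x)).baseSet :=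
  hF.continuous.continuousAt.preimage_mem_nhds (mem_baseSet_tangent_nhds (F x))

end Map

/-! ### Metric components and Christoffel symbols -/

section Metric
variable {E : Type*} [NormedAddCommGroup E] [NormedSpace ℝ E] [FiniteDimensional ℝ E]
  {M : Type*} [TopologicalSpace M] [ChartedSpace E M] [IsManifold 𝓘(ℝ, E) ∞ M]
  (g : SemiRiemannianMetric E M)

theorem SemiRiemannianMetric.contMDiffAt_inner {X Y : ∀ x : M, TangentSpace 𝓘(ℝ, E) x} {x : M}
    (hX : ContMDiffAt 𝓘(ℝ, E) (𝓘(ℝ, E).prod 𝓘(ℝ, E)) ∞ (fun y ↦ TotalSpace.mk' E y (X y)) x)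
    (hY : ContMDiffAt 𝓘(ℝ, E) (𝓘(ℝ, E).prod 𝓘(ℝ, E)) ∞ (fun y ↦ TotalSpace.mk' E y (Y y)) x) :
    ContMDiffAt 𝓘(ℝ, E) 𝓘(ℝ) ∞ (fun y ↦ g.inner y (X y) (Y y)) x := by
  have h := ContMDiffAt.clm_bundle_apply₂ (F₁ := E) (F₂ := E) (F₃ := ℝ)
    (E₁ := (TangentSpace 𝓘(ℝ, E) : M → Type _)) (E₂ := (TangentSpace 𝓘(ℝ, E) : M → Type _))
    (E₃ := Bundle.Trivial M ℝ) (b := fun y ↦ y)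
    (g.contMDiff.contMDiffAt (x := x)) hX hY
  rw [contMDiffAt_totalSpace] at h
  exact h.2

theorem SemiRiemannianMetric.coord_apply (x y : M) (v w : E) :
    g.coord x y v w = g.inner y (ofCoord x y v) (ofCoord x y w) := rfl

theorem SemiRiemannianMetric.coord_symm (x y : M) (v w : E) :
    g.coord x y v w = g.coord x y w v := g.symm _ _ _

/-- In a basis of `E` the matrix entries are scalar products of coordinate fields, hence smooth. -/
theorem SemiRiemannianMetric.contMDiffAt_coord (x : M) :
    ContMDiffAt 𝓘(ℝ, E) 𝓘(ℝ, E →L[ℝ] E →L[ℝ] ℝ) ∞ (g.coord x) x := by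
  let b := Module.finBasis ℝ E
  let c : Fin (Module.finrank ℝ E) → E →L[ℝ] ℝ := fun i ↦
    LinearMap.toContinuousLinearMap (b.coord i)
  have h : g.coord x = fun y ↦ ∑ i, ∑ j,
      g.inner y (ofCoord x y (b i)) (ofCoord x y (b j)) • (c i).smulRight (c j) := by
    ext y v w
    conv_lhs => rw [← b.sum_repr v, ← b.sum_repr w]
    simp only [map_sum, map_smul, _root_.sum_apply, _root_.smul_apply,
      g.coord_apply, ContinuousLinearMap.smulRight_apply, smul_eq_mul, c,
      LinearMap.coe_toContinuousLinearMap', Module.Basis.coord_apply, Finset.mul_sum]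
    rw [Finset.sum_comm]
    refine Finset.sum_congr rfl fun i _ ↦ Finset.sum_congr rfl fun j _ ↦ by ring
  rw [h]
  refine ContMDiffAt.sum fun i _ ↦ ContMDiffAt.sum fun j _ ↦ ?_
  exact (g.contMDiffAt_inner (contMDiffAt_ofCoord x _) (contMDiffAt_ofCoord x _)).smul
    contMDiffAt_const

theorem SemiRiemannianMetric.mdifferentiableAt_coord (x : M) :
    MDifferentiableAt 𝓘(ℝ, E) 𝓘(ℝ, E →L[ℝ] E →L[ℝ] ℝ) (g.coord x) x :=
  (g.contMDiffAt_coord x).mdifferentiableAt (by simp)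

theorem SemiRiemannianMetric.mvfderiv_coord_apply (x : M) (u : TangentSpace 𝓘(ℝ, E) x) (a b : E) :
    mvfderiv 𝓘(ℝ, E) (g.coord x) x u a b = mvfderiv 𝓘(ℝ, E) (fun y ↦ g.coord x y a b) x u := by
  have h1 := mvfderiv_clm_apply (g.mdifferentiableAt_coord x)
    (mdifferentiableAt_const (c := a)) u
  have h2 := mvfderiv_clm_apply h1.1 (mdifferentiableAt_const (c := b)) u
  rw [h2.2, h1.2, mvfderiv_const, mvfderiv_const]
  simp

theorem SemiRiemannianMetric.dcoord_symm (x : M) (u v w : TangentSpace 𝓘(ℝ, E) x) :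
    g.dcoord x u v w = g.dcoord x u w v := by
  unfold dcoord
  rw [g.mvfderiv_coord_apply, g.mvfderiv_coord_apply]
  simp_rw [g.coord_symm x _ (toCoord x x v)]

theorem SemiRiemannianMetric.inner_sharp (x : M) (α : Module.Dual ℝ (TangentSpace 𝓘(ℝ, E) x))
    (w : TangentSpace 𝓘(ℝ, E) x) : g.inner x (g.sharp x α) w = α w :=
  LinearMap.BilinForm.apply_toDual_symm_apply (hB := g.bilin_nondegenerate x) α w

theorem SemiRiemannianMetric.inner_christoffel (x : M) (u v w : TangentSpace 𝓘(ℝ, E) x) :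
    g.inner x (g.christoffel x u v) w =
      (1 / 2 : ℝ) * (g.dcoord x u v w + g.dcoord x v u w - g.dcoord x w u v) :=
  g.inner_sharp x _ w

theorem SemiRiemannianMetric.eq_of_inner_eq (x : M) {v w : TangentSpace 𝓘(ℝ, E) x}
    (h : ∀ u, g.inner x v u = g.inner x w u) : v = w := by
  rw [← sub_eq_zero]
  refine g.nondegenerate x _ fun u ↦ ?_
  rw [map_sub, _root_.sub_apply, h, sub_self]

theorem SemiRiemannianMetric.christoffel_symm (x : M) (u v : TangentSpace 𝓘(ℝ, E) x) :
    g.christoffel x u v = g.christoffel x v u := by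
  refine g.eq_of_inner_eq x fun w ↦ ?_
  rw [g.inner_christoffel, g.inner_christoffel, g.dcoord_symm x w u v]
  ring

/-- Metric compatibility at the level of symbols: the terms differentiated along `v` and `w` cancel
in pairs. -/
theorem SemiRiemannianMetric.inner_christoffel_add (x : M) (u v w : TangentSpace 𝓘(ℝ, E) x) :
    g.inner x (g.christoffel x u v) w + g.inner x v (g.christoffel x u w) =
      g.dcoord x u v w := by
  rw [g.symm x v, g.inner_christoffel, g.inner_christoffel, g.dcoord_symm x w u v,
    g.dcoord_symm x v u w, g.dcoord_symm x u w v]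
  ring

end Metric

/-! ### The pullback connection: metric compatibility and vanishing torsion -/

section Connection
variable {E : Type*} [NormedAddCommGroup E] [NormedSpace ℝ E]
  {M : Type*} [TopologicalSpace M] [ChartedSpace E M] [IsManifold 𝓘(ℝ, E) ∞ M]
  {E' : Type*} [NormedAddCommGroup E'] [NormedSpace ℝ E'] [FiniteDimensional ℝ E']
  {N : Type*} [TopologicalSpace N] [ChartedSpace E' N] [IsManifold 𝓘(ℝ, E') ∞ N]
  (gN : SemiRiemannianMetric E' N) {F : M → N}

/-- `∇^F` is compatible with the metric. -/
theorem mvfderiv_inner_comp (hF : ContMDiff 𝓘(ℝ, E) 𝓘(ℝ, E') ∞ F)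
    {s t : ∀ x : M, TangentSpace 𝓘(ℝ, E') (F x)} {x : M}
    (hs : MDifferentiableAt 𝓘(ℝ, E) 𝓘(ℝ, E') (fun y ↦ toCoord (F x) (F y) (s y)) x)
    (ht : MDifferentiableAt 𝓘(ℝ, E) 𝓘(ℝ, E') (fun y ↦ toCoord (F x) (F y) (t y)) x)
    (v : TangentSpace 𝓘(ℝ, E) x) :
    mvfderiv 𝓘(ℝ, E) (fun y ↦ gN.inner (F y) (s y) (t y)) x v =
      gN.inner (F x) (pullbackCov gN F s x v) (t x) +
        gN.inner (F x) (s x) (pullbackCov gN F t x v) := by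
  have hG := gN.mdifferentiableAt_coord (F x)
  have hFx : MDifferentiableAt 𝓘(ℝ, E) 𝓘(ℝ, E') F x := hF.mdifferentiableAt (by simp)
  have hGF : MDifferentiableAt 𝓘(ℝ, E) 𝓘(ℝ, E' →L[ℝ] E' →L[ℝ] ℝ)
      (fun y ↦ gN.coord (F x) (F y)) x := hG.comp x hFx
  have e : (fun y ↦ gN.inner (F y) (s y) (t y)) =ᶠ[𝓝 x] fun y ↦
      gN.coord (F x) (F y) (toCoord (F x) (F y) (s y)) (toCoord (F x) (F y) (t y)) := by
    filter_upwards [eventually_mem_baseSet_comp hF x] with y hy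
    rw [gN.coord_apply, ofCoord_toCoord_of_mem hy, ofCoord_toCoord_of_mem hy]
  have h1 := mvfderiv_clm_apply hGF hs v
  have h2 := mvfderiv_clm_apply h1.1 ht v
  rw [e.mvfderiv_apply_eq, h2.2, h1.2, mvfderiv_comp_mfderiv hG hFx]
  -- The product rule leaves a derivative of the metric components; the two Christoffel terms
  -- account for it exactly.
  have h4 := gN.inner_christoffel_add (F x) (mfderiv 𝓘(ℝ, E) 𝓘(ℝ, E') F x v) (s x) (t x)
  unfold SemiRiemannianMetric.dcoord at h4
  unfold pullbackCov
  simp only [gN.coord_apply, map_add, _root_.add_apply, ofCoord_toCoord]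
  rw [← h4]
  ring

theorem contMDiffAt_mfderiv_apply (hF : ContMDiff 𝓘(ℝ, E) 𝓘(ℝ, E') ∞ F)
    {Y : ∀ x : M, TangentSpace 𝓘(ℝ, E) x} {x : M}
    (hY : ContMDiffAt 𝓘(ℝ, E) (𝓘(ℝ, E).prod 𝓘(ℝ, E)) ∞ (fun y ↦ TotalSpace.mk' E y (Y y)) x) :
    ContMDiffAt 𝓘(ℝ, E) (𝓘(ℝ, E').prod 𝓘(ℝ, E')) ∞
      (fun y ↦ TotalSpace.mk' E' (F y) (mfderiv 𝓘(ℝ, E) 𝓘(ℝ, E') F y (Y y))) x :=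
  ((hF.contMDiff_tangentMap (m := ∞) (by simp)).contMDiffAt).comp x hY

theorem contMDiffAt_toCoord_mfderiv (hF : ContMDiff 𝓘(ℝ, E) 𝓘(ℝ, E') ∞ F)
    {Y : ∀ x : M, TangentSpace 𝓘(ℝ, E) x} {x : M}
    (hY : ContMDiffAt 𝓘(ℝ, E) (𝓘(ℝ, E).prod 𝓘(ℝ, E)) ∞ (fun y ↦ TotalSpace.mk' E y (Y y)) x) :
    ContMDiffAt 𝓘(ℝ, E) 𝓘(ℝ, E') ∞
      (fun y ↦ toCoord (F x) (F y) (mfderiv 𝓘(ℝ, E) 𝓘(ℝ, E') F y (Y y))) x := by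
  have h := contMDiffAt_mfderiv_apply hF hY
  rw [contMDiffAt_totalSpace] at h
  refine h.2.congr_of_eventuallyEq ?_
  filter_upwards [eventually_mem_baseSet_comp hF x] with y hy
  exact toCoord_apply_of_mem hy _

/-- `∇^F` is torsion-free. -/
theorem pullbackCov_sub_pullbackCov (hF : ContMDiff 𝓘(ℝ, E) 𝓘(ℝ, E') ∞ F) [CompleteSpace E]
    {X Y : ∀ x : M, TangentSpace 𝓘(ℝ, E) x} {x : M} (hX : MDiffAt (T% X) x)
    (hY : MDiffAt (T% Y) x) :
    pullbackCov gN F (fun y ↦ mfderiv 𝓘(ℝ, E) 𝓘(ℝ, E') F y (Y y)) x (X x) -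
      pullbackCov gN F (fun y ↦ mfderiv 𝓘(ℝ, E) 𝓘(ℝ, E') F y (X y)) x (Y x) =
      mfderiv 𝓘(ℝ, E) 𝓘(ℝ, E') F x (VectorField.mlieBracket 𝓘(ℝ, E) X Y x) := by
  have e : ∀ (Z : ∀ x : M, TangentSpace 𝓘(ℝ, E) x) (v : TangentSpace 𝓘(ℝ, E) x),
      mvfderiv 𝓘(ℝ, E) (fun y ↦ toCoord (F x) (F y) (mfderiv 𝓘(ℝ, E) 𝓘(ℝ, E') F y (Z y))) x v =
      mvfderiv 𝓘(ℝ, E) (fun y ↦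
        mvfderiv 𝓘(ℝ, E) (fun z ↦ extChartAt 𝓘(ℝ, E') (F x) (F z)) y (Z y)) x v := by
    intro Z v
    refine EventuallyEq.mvfderiv_apply_eq ?_ v
    filter_upwards [eventually_mem_baseSet_comp hF x] with y hy
    rw [toCoord_mfderiv hF hy]
  unfold pullbackCov
  -- The Christoffel terms cancel by symmetry; what is left is the commutator of `X` and `Y` acting
  -- on the chart composed with `F`.
  rw [e, e, gN.christoffel_symm, add_sub_add_right_eq_sub, ← map_sub, ← mvfderiv_mlieBracket
    (contMDiffAt_extChartAt_comp hF x) hX hY, ← toCoord_mfderiv hF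
    (mem_baseSet_trivializationAt E' (TangentSpace 𝓘(ℝ, E')) (F x)), ofCoord_toCoord]

end Connection

/-! ### The Levi-Civita connection as the pullback along the identity -/

section LeviCivita
variable {E : Type*} [NormedAddCommGroup E] [NormedSpace ℝ E] [FiniteDimensional ℝ E]
  {M : Type*} [TopologicalSpace M] [ChartedSpace E M] [IsManifold 𝓘(ℝ, E) ∞ M]
  (g : SemiRiemannianMetric E M)

theorem pullbackCov_id (Y : ∀ x : M, TangentSpace 𝓘(ℝ, E) x) (x : M)
    (v : TangentSpace 𝓘(ℝ, E) x) : pullbackCov g id Y x v = g.leviCivita Y x v := by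
  unfold pullbackCov
  rw [mfderiv_id]
  rfl

theorem SemiRiemannianMetric.mvfderiv_inner {Y Z : ∀ x : M, TangentSpace 𝓘(ℝ, E) x} {x : M}
    (hY : MDiffAt (T% Y) x) (hZ : MDiffAt (T% Z) x) (v : TangentSpace 𝓘(ℝ, E) x) :
    mvfderiv 𝓘(ℝ, E) (fun y ↦ g.inner y (Y y) (Z y)) x v =
      g.inner x (g.leviCivita Y x v) (Z x) + g.inner x (Y x) (g.leviCivita Z x v) := by
  rw [← pullbackCov_id, ← pullbackCov_id]
  exact mvfderiv_inner_comp g (F := id) contMDiff_id (mdifferentiableAt_toCoord hY)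
    (mdifferentiableAt_toCoord hZ) v

theorem SemiRiemannianMetric.leviCivita_sub_leviCivita
    {X Y : ∀ x : M, TangentSpace 𝓘(ℝ, E) x} {x : M}
    (hX : MDiffAt (T% X) x) (hY : MDiffAt (T% Y) x) :
    g.leviCivita Y x (X x) - g.leviCivita X x (Y x) =
      VectorField.mlieBracket 𝓘(ℝ, E) X Y x := by
  have := FiniteDimensional.complete ℝ E
  have h := pullbackCov_sub_pullbackCov g (F := id) contMDiff_id hX hY
  simp only [mfderiv_id] at h
  rw [← pullbackCov_id, ← pullbackCov_id]
  exact h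

end LeviCivita

/-! ### Smoothness tested by scalar products, and extension of vectors -/

section Smooth
variable {E : Type*} [NormedAddCommGroup E] [NormedSpace ℝ E] [FiniteDimensional ℝ E]
  {M : Type*} [TopologicalSpace M] [ChartedSpace E M] [IsManifold 𝓘(ℝ, E) ∞ M]
  (g : SemiRiemannianMetric E M)

theorem SemiRiemannianMetric.isInvertible_coord {x y : M}
    (hy : y ∈ (trivializationAt E (TangentSpace 𝓘(ℝ, E)) x).baseSet) :
    (g.coord x y).IsInvertible := by
  have hinj : Function.Injective (g.coord x y).toLinearMap := by
    rw [← LinearMap.ker_eq_bot, LinearMap.ker_eq_bot']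
    intro v hv
    have h0 : ofCoord x y v = 0 := by
      refine g.nondegenerate y _ fun w ↦ ?_
      have := congrArg (fun T : E →L[ℝ] ℝ ↦ T (toCoord x y w)) hv
      simpa [g.coord_apply, ofCoord_toCoord_of_mem hy] using this
    rw [← toCoord_ofCoord_of_mem hy v, h0, map_zero]
  have hdim : Module.finrank ℝ E = Module.finrank ℝ (E →L[ℝ] ℝ) := by
    rw [← (LinearMap.toContinuousLinearMap (𝕜 := ℝ) (E := E) (F' := ℝ)).finrank_eq]
    exact (Subspace.dual_finrank_eq (K := ℝ) (V := E)).symm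
  refine ⟨(LinearEquiv.ofInjectiveOfFinrankEq (g.coord x y).toLinearMap hinj
    hdim).toContinuousLinearEquiv, ?_⟩
  ext v w
  rfl

/-- A vector field is smooth if its scalar products with smooth vector fields are smooth. -/
theorem SemiRiemannianMetric.contMDiffAt_of_inner {Z : ∀ x : M, TangentSpace 𝓘(ℝ, E) x} {x : M}
    (h : ∀ W : ∀ x : M, TangentSpace 𝓘(ℝ, E) x,
      ContMDiffAt 𝓘(ℝ, E) (𝓘(ℝ, E).prod 𝓘(ℝ, E)) ∞ (fun y ↦ TotalSpace.mk' E y (W y)) x →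
      ContMDiffAt 𝓘(ℝ, E) 𝓘(ℝ) ∞ (fun y ↦ g.inner y (Z y) (W y)) x) :
    ContMDiffAt 𝓘(ℝ, E) (𝓘(ℝ, E).prod 𝓘(ℝ, E)) ∞ (fun y ↦ TotalSpace.mk' E y (Z y)) x := by
  rw [contMDiffAt_section_iff_toCoord]
  let b := Module.finBasis ℝ E
  let c : Fin (Module.finrank ℝ E) → E →L[ℝ] ℝ := fun i ↦
    LinearMap.toContinuousLinearMap (b.coord i)
  let θ : M → E →L[ℝ] ℝ := fun y ↦ ∑ j, g.inner y (Z y) (ofCoord x y (b j)) • c j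
  have hθ : ContMDiffAt 𝓘(ℝ, E) 𝓘(ℝ, E →L[ℝ] ℝ) ∞ θ x :=
    ContMDiffAt.sum fun j _ ↦ (h _ (contMDiffAt_ofCoord x _)).smul contMDiffAt_const
  have hinv : ContMDiffAt 𝓘(ℝ, E) 𝓘(ℝ, (E →L[ℝ] ℝ) →L[ℝ] E) ∞
      (fun y ↦ (g.coord x y).inverse) x := by
    have := (g.isInvertible_coord (mem_baseSet_trivializationAt E (TangentSpace 𝓘(ℝ, E))
      x)).contDiffAt_map_inverse (n := ∞)
    exact this.contMDiffAt.comp x (g.contMDiffAt_coord x)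
  -- The coordinates of `Z` are the inverse metric matrix applied to the covector `θ` = g(Z, ·).
  refine (hinv.clm_apply hθ).congr_of_eventuallyEq ?_
  filter_upwards [mem_baseSet_tangent_nhds (E := E) x] with y hy
  rw [eq_comm, (g.isInvertible_coord hy).inverse_apply_eq]
  ext w
  simp only [θ, c, g.coord_apply, ofCoord_toCoord_of_mem hy, _root_.sum_apply, _root_.smul_apply,
    LinearMap.coe_toContinuousLinearMap', Module.Basis.coord_apply, smul_eq_mul]
  conv_rhs => rw [← b.sum_repr w]
  simp only [map_sum, map_smul, smul_eq_mul, mul_comm]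

/-- Every tangent vector extends to a smooth vector field. -/
theorem exists_isSmoothField_eq [T2Space M] (x : M) (v : TangentSpace 𝓘(ℝ, E) x) :
    ∃ X : ∀ x : M, TangentSpace 𝓘(ℝ, E) x, IsSmoothField X ∧ X x = v := by
  obtain ⟨s, hs, hXs⟩ := FiberBundle.exists_contMDiffOn_extend (k := ∞) 𝓘(ℝ, E) E v
  obtain ⟨u, hus, hu, hxu⟩ := mem_nhds_iff.1 hs
  obtain ⟨ρ, -, hρ⟩ := (SmoothBumpFunction.nhds_basis_tsupport (I := 𝓘(ℝ, E)) x).mem_iff.1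
    (hu.mem_nhds hxu)
  refine ⟨(ρ : M → ℝ) • FiberBundle.extend E v, ?_, ?_⟩
  · exact ContMDiffOn.smul_section_of_tsupport ρ.contMDiff.contMDiffOn hu hρ (hXs.mono hus)
  · simp

end Smooth

/-! ### Operations on smooth vector fields -/

section Fields
variable {E : Type*} [NormedAddCommGroup E] [NormedSpace ℝ E]
  {M : Type*} [TopologicalSpace M] [ChartedSpace E M] [IsManifold 𝓘(ℝ, E) ∞ M]
  {X Y : ∀ x : M, TangentSpace 𝓘(ℝ, E) x}

theorem IsSmoothField.mdifferentiableAt (hX : IsSmoothField X) (x : M) : MDiffAt (T% X) x :=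
  (ContMDiff.contMDiffAt hX).mdifferentiableAt (by simp)

theorem IsSmoothField.sub (hX : IsSmoothField X) (hY : IsSmoothField Y) :
    IsSmoothField (fun x ↦ X x - Y x) := ContMDiff.sub_section hX hY

theorem IsSmoothField.const_smul (c : ℝ) (hX : IsSmoothField X) : IsSmoothField (fun x ↦ c • X x) :=
  ContMDiff.const_smul_section hX

theorem IsSmoothField.mlieBracket [CompleteSpace E] (hX : IsSmoothField X) (hY : IsSmoothField Y) :
    IsSmoothField (VectorField.mlieBracket 𝓘(ℝ, E) X Y) := by
  have : IsManifold 𝓘(ℝ, E) (minSmoothness ℝ 2) M := by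
    rw [minSmoothness_of_isRCLikeNormedField]
    infer_instance
  have : IsManifold 𝓘(ℝ, E) (((⊤ : ℕ∞) : WithTop ℕ∞) + 1) M := by
    simpa using (inferInstance : IsManifold 𝓘(ℝ, E) ∞ M)
  exact ContDiff.mlieBracket_vectorField (m := ⊤) (n := ⊤) hX hY (by simp)

theorem IsSmoothField.leibniz_identity [CompleteSpace E] {Z : ∀ x : M, TangentSpace 𝓘(ℝ, E) x}
    (hX : IsSmoothField X) (hY : IsSmoothField Y) (hZ : IsSmoothField Z) {x : M} :
    VectorField.mlieBracket 𝓘(ℝ, E) X (VectorField.mlieBracket 𝓘(ℝ, E) Y Z) x =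
      VectorField.mlieBracket 𝓘(ℝ, E) (VectorField.mlieBracket 𝓘(ℝ, E) X Y) Z x +
        VectorField.mlieBracket 𝓘(ℝ, E) Y (VectorField.mlieBracket 𝓘(ℝ, E) X Z) x := by
  have : IsManifold 𝓘(ℝ, E) (minSmoothness ℝ 3) M := by
    rw [minSmoothness_of_isRCLikeNormedField]
    infer_instance
  have h : minSmoothness ℝ 2 ≤ ∞ := by
    rw [minSmoothness_of_isRCLikeNormedField]
    exact ENat.LEInfty.out
  exact VectorField.leibniz_identity_mlieBracket_apply ((hX x).of_le h) ((hY x).of_le h)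
    ((hZ x).of_le h)

end Fields

/-! ### Vertical and horizontal parts -/

section Submersion
variable {E : Type*} [NormedAddCommGroup E] [NormedSpace ℝ E] [FiniteDimensional ℝ E]
  {M : Type*} [TopologicalSpace M] [ChartedSpace E M] [IsManifold 𝓘(ℝ, E) ∞ M]
  {E' : Type*} [NormedAddCommGroup E'] [NormedSpace ℝ E'] [FiniteDimensional ℝ E']
  {N : Type*} [TopologicalSpace N] [ChartedSpace E' N] [IsManifold 𝓘(ℝ, E') ∞ N]
  {gM : SemiRiemannianMetric E M} {gN : SemiRiemannianMetric E' N} {F : M → N}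

theorem inner_eq_zero_of_vertical_of_horizontal {x : M} {v w : TangentSpace 𝓘(ℝ, E) x}
    (hv : v ∈ vertical E E' F x) (hw : w ∈ horizontal E' gM F x) : gM.inner x v w = 0 := hw v hv

theorem inner_eq_zero_of_horizontal_of_vertical {x : M} {v w : TangentSpace 𝓘(ℝ, E) x}
    (hv : v ∈ horizontal E' gM F x) (hw : w ∈ vertical E E' F x) : gM.inner x v w = 0 := by
  rw [gM.symm]
  exact hv w hw

theorem mfderiv_eq_zero_of_vertical {x : M} {v : TangentSpace 𝓘(ℝ, E) x}
    (hv : v ∈ vertical E E' F x) : mfderiv 𝓘(ℝ, E) 𝓘(ℝ, E') F x v = 0 := hv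

namespace IsSemiRiemannianSubmersion
variable (hF : IsSemiRiemannianSubmersion gM gN F) {x : M}

theorem verticalPart_mem (v : TangentSpace 𝓘(ℝ, E) x) :
    hF.verticalPart x v ∈ vertical E E' F x := Submodule.projection_apply_mem _ _

theorem horizontalPart_mem (v : TangentSpace 𝓘(ℝ, E) x) :
    hF.horizontalPart x v ∈ horizontal E' gM F x := Submodule.projection_apply_mem _ _

theorem verticalPart_add_horizontalPart (v : TangentSpace 𝓘(ℝ, E) x) :
    hF.verticalPart x v + hF.horizontalPart x v = v :=
  Submodule.projection_add_projection_eq_self (hF.isCompl x) v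

theorem verticalPart_of_mem {v : TangentSpace 𝓘(ℝ, E) x} (hv : v ∈ vertical E E' F x) :
    hF.verticalPart x v = v := Submodule.projection_apply_of_mem_left (hF.isCompl x) hv

theorem horizontalPart_of_mem {v : TangentSpace 𝓘(ℝ, E) x} (hv : v ∈ horizontal E' gM F x) :
    hF.horizontalPart x v = v := Submodule.projection_apply_of_mem_left (hF.isCompl x).symm hv

theorem horizontalPart_of_vertical {v : TangentSpace 𝓘(ℝ, E) x}
    (hv : v ∈ vertical E E' F x) : hF.horizontalPart x v = 0 := by
  simpa [hF.verticalPart_of_mem hv] using hF.verticalPart_add_horizontalPart v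

/-- The horizontal part of `v` is orthogonal to both summands of the tangent space, so nondegeneracy
kills it. -/
theorem mem_vertical_of_inner (hF : IsSemiRiemannianSubmersion gM gN F)
    {v : TangentSpace 𝓘(ℝ, E) x}
    (h : ∀ w ∈ horizontal E' gM F x, gM.inner x v w = 0) : v ∈ vertical E E' F x := by
  have h0 : hF.horizontalPart x v = 0 := by
    refine gM.nondegenerate x _ fun w ↦ ?_
    rw [← hF.verticalPart_add_horizontalPart w, map_add,
      inner_eq_zero_of_horizontal_of_vertical (hF.horizontalPart_mem v) (hF.verticalPart_mem w),
      zero_add, ← h _ (hF.horizontalPart_mem w)]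
    conv_rhs => rw [← hF.verticalPart_add_horizontalPart v]
    rw [map_add, _root_.add_apply, inner_eq_zero_of_vertical_of_horizontal (hF.verticalPart_mem v)
      (hF.horizontalPart_mem w), zero_add]
  have h1 := hF.verticalPart_add_horizontalPart v
  rw [h0, add_zero] at h1
  rw [← h1]
  exact hF.verticalPart_mem v

theorem mfderiv_horizontalPart (v : TangentSpace 𝓘(ℝ, E) x) :
    mfderiv 𝓘(ℝ, E) 𝓘(ℝ, E') F x (hF.horizontalPart x v) =
      mfderiv 𝓘(ℝ, E) 𝓘(ℝ, E') F x v := by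
  conv_rhs => rw [← hF.verticalPart_add_horizontalPart v]
  rw [map_add, mfderiv_eq_zero_of_vertical (hF.verticalPart_mem v), zero_add]

/-- The differential of `F` is isometric as soon as one argument is horizontal. -/
theorem inner_mfderiv (hF : IsSemiRiemannianSubmersion gM gN F)
    (v : TangentSpace 𝓘(ℝ, E) x) {w : TangentSpace 𝓘(ℝ, E) x}
    (hw : w ∈ horizontal E' gM F x) :
    gN.inner (F x) (mfderiv 𝓘(ℝ, E) 𝓘(ℝ, E') F x v) (mfderiv 𝓘(ℝ, E) 𝓘(ℝ, E') F x w) =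
      gM.inner x v w := by
  rw [← hF.mfderiv_horizontalPart v, hF.isometry x _ _ (hF.horizontalPart_mem v) hw]
  conv_rhs => rw [← hF.verticalPart_add_horizontalPart v]
  rw [map_add, _root_.add_apply, inner_eq_zero_of_vertical_of_horizontal (hF.verticalPart_mem v) hw,
    zero_add]

theorem inner_horizontalPart (v w : TangentSpace 𝓘(ℝ, E) x) :
    gM.inner x (hF.horizontalPart x v) w =
      gN.inner (F x) (mfderiv 𝓘(ℝ, E) 𝓘(ℝ, E') F x v) (mfderiv 𝓘(ℝ, E) 𝓘(ℝ, E') F x w) := by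
  rw [gN.symm, ← hF.mfderiv_horizontalPart v, hF.inner_mfderiv _ (hF.horizontalPart_mem v), gM.symm]

/-- The scalar product of ℋX with any `W` equals that of F_*X and F_*W, which is visibly smooth; no
local frame of the vertical bundle is needed. -/
theorem isSmoothField_horizontalPart {X : ∀ x : M, TangentSpace 𝓘(ℝ, E) x} (hX : IsSmoothField X) :
    IsSmoothField (fun x ↦ hF.horizontalPart x (X x)) := by
  intro x
  refine gM.contMDiffAt_of_inner fun W hW ↦ ?_
  have e : (fun y ↦ gM.inner y (hF.horizontalPart y (X y)) (W y)) =ᶠ[𝓝 x] fun y ↦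
      gN.coord (F x) (F y) (toCoord (F x) (F y) (mfderiv 𝓘(ℝ, E) 𝓘(ℝ, E') F y (X y)))
        (toCoord (F x) (F y) (mfderiv 𝓘(ℝ, E) 𝓘(ℝ, E') F y (W y))) := by
    filter_upwards [eventually_mem_baseSet_comp hF.contMDiff x] with y hy
    rw [gN.coord_apply, ofCoord_toCoord_of_mem hy, ofCoord_toCoord_of_mem hy,
      hF.inner_horizontalPart]
  refine ContMDiffAt.congr_of_eventuallyEq ?_ e
  have hG := (gN.contMDiffAt_coord (F x)).comp x hF.contMDiff.contMDiffAt
  exact (hG.clm_apply (contMDiffAt_toCoord_mfderiv hF.contMDiff (hX x))).clm_apply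
    (contMDiffAt_toCoord_mfderiv hF.contMDiff hW)

theorem isSmoothField_verticalPart {X : ∀ x : M, TangentSpace 𝓘(ℝ, E) x} (hX : IsSmoothField X) :
    IsSmoothField (fun x ↦ hF.verticalPart x (X x)) := by
  convert hX.sub (hF.isSmoothField_horizontalPart hX) using 2 with x
  exact eq_sub_of_add_eq (hF.verticalPart_add_horizontalPart _)

theorem exists_isVerticalField_eq (hF : IsSemiRiemannianSubmersion gM gN F) [T2Space M]
    {v : TangentSpace 𝓘(ℝ, E) x}
    (hv : v ∈ vertical E E' F x) :
    ∃ V : ∀ x : M, TangentSpace 𝓘(ℝ, E) x, IsVerticalField E' F V ∧ V x = v := by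
  obtain ⟨X, hX, rfl⟩ := exists_isSmoothField_eq x v
  exact ⟨fun y ↦ hF.verticalPart y (X y), ⟨hF.isSmoothField_verticalPart hX,
    fun y ↦ hF.verticalPart_mem _⟩, hF.verticalPart_of_mem hv⟩

theorem exists_isHorizontalField_eq (hF : IsSemiRiemannianSubmersion gM gN F) [T2Space M]
    {v : TangentSpace 𝓘(ℝ, E) x}
    (hv : v ∈ horizontal E' gM F x) :
    ∃ V : ∀ x : M, TangentSpace 𝓘(ℝ, E) x, IsHorizontalField E' gM F V ∧ V x = v := by
  obtain ⟨X, hX, rfl⟩ := exists_isSmoothField_eq x v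
  exact ⟨fun y ↦ hF.horizontalPart y (X y), ⟨hF.isSmoothField_horizontalPart hX,
    fun y ↦ hF.horizontalPart_mem _⟩, hF.horizontalPart_of_mem hv⟩

end IsSemiRiemannianSubmersion
end Submersion

/-! ### Second fundamental form of the map and alternation of 𝒜 -/

section Submersion
variable {E : Type*} [NormedAddCommGroup E] [NormedSpace ℝ E] [FiniteDimensional ℝ E]
  {M : Type*} [TopologicalSpace M] [ChartedSpace E M] [IsManifold 𝓘(ℝ, E) ∞ M]
  {E' : Type*} [NormedAddCommGroup E'] [NormedSpace ℝ E'] [FiniteDimensional ℝ E']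
  {N : Type*} [TopologicalSpace N] [ChartedSpace E' N] [IsManifold 𝓘(ℝ, E') ∞ N]
  {gM : SemiRiemannianMetric E M} {gN : SemiRiemannianMetric E' N} {F : M → N}
  {X Y Z V W : ∀ x : M, TangentSpace 𝓘(ℝ, E) x}

theorem pullbackCov_zero (x : M) (v : TangentSpace 𝓘(ℝ, E) x) :
    pullbackCov gN F (fun _ ↦ 0) x v = 0 := by
  unfold pullbackCov
  simp only [map_zero]
  rw [mvfderiv_const]
  simp

theorem SemiRiemannianMetric.inner_leviCivita_of_inner_eq_const (g : SemiRiemannianMetric E M)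
    {c : ℝ} (hY : IsSmoothField Y) (hZ : IsSmoothField Z) (h : ∀ x, g.inner x (Y x) (Z x) = c)
    (x : M) (v : TangentSpace 𝓘(ℝ, E) x) :
    g.inner x (g.leviCivita Y x v) (Z x) = -g.inner x (Y x) (g.leviCivita Z x v) := by
  have h1 := g.mvfderiv_inner (hY.mdifferentiableAt x) (hZ.mdifferentiableAt x) v
  simp only [h] at h1
  rw [mvfderiv_const] at h1
  simp only [_root_.zero_apply] at h1
  linarith

theorem SemiRiemannianMetric.mlieBracket_eq (g : SemiRiemannianMetric E M)
    (hX : IsSmoothField X) (hY : IsSmoothField Y) (x : M) :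
    VectorField.mlieBracket 𝓘(ℝ, E) X Y x = g.leviCivita Y x (X x) - g.leviCivita X x (Y x) :=
  (g.leviCivita_sub_leviCivita (hX.mdifferentiableAt x) (hY.mdifferentiableAt x)).symm

/-- Both connections are torsion-free, so each antisymmetric part is F_*[X, Y]. -/
theorem secondFundamentalForm_symm (hF : ContMDiff 𝓘(ℝ, E) 𝓘(ℝ, E') ∞ F)
    (hX : IsSmoothField X) (hY : IsSmoothField Y) (x : M) :
    secondFundamentalForm gM gN F X Y x = secondFundamentalForm gM gN F Y X x := by
  have := FiniteDimensional.complete ℝ E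
  have h := pullbackCov_sub_pullbackCov gN hF (hX.mdifferentiableAt x) (hY.mdifferentiableAt x)
  rw [gM.mlieBracket_eq hX hY, map_sub] at h
  unfold secondFundamentalForm
  rw [sub_eq_sub_iff_sub_eq_sub, h]

theorem secondFundamentalForm_of_vertical (hV : IsVerticalField E' F V) (x : M) :
    secondFundamentalForm gM gN F X V x =
      -mfderiv 𝓘(ℝ, E) 𝓘(ℝ, E') F x (gM.leviCivita V x (X x)) := by
  unfold secondFundamentalForm
  have : (fun y ↦ mfderiv 𝓘(ℝ, E) 𝓘(ℝ, E') F y (V y)) = fun _ ↦ 0 :=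
    funext fun y ↦ mfderiv_eq_zero_of_vertical (hV.2 y)
  rw [this, pullbackCov_zero, zero_sub]

namespace IsSemiRiemannianSubmersion

/-- The vertical distribution is integrable. -/
theorem mlieBracket_mem_vertical (hF : IsSemiRiemannianSubmersion gM gN F)
    (hV : IsVerticalField E' F V) (hW : IsVerticalField E' F W) (x : M) :
    VectorField.mlieBracket 𝓘(ℝ, E) V W x ∈ vertical E E' F x := by
  have := FiniteDimensional.complete ℝ E
  have h := pullbackCov_sub_pullbackCov gN hF.contMDiff (hV.1.mdifferentiableAt x)
    (hW.1.mdifferentiableAt x)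
  have h0 : ∀ {U : ∀ x : M, TangentSpace 𝓘(ℝ, E) x}, IsVerticalField E' F U →
      (fun y ↦ mfderiv 𝓘(ℝ, E) 𝓘(ℝ, E') F y (U y)) = fun _ ↦ 0 :=
    fun hU ↦ funext fun y ↦ mfderiv_eq_zero_of_vertical (hU.2 y)
  rw [h0 hV, h0 hW, pullbackCov_zero, pullbackCov_zero, sub_zero] at h
  exact h.symm

/-- O'Neill's tensor `𝒜` is alternating on horizontal fields. -/
theorem inner_leviCivita_vertical (hF : IsSemiRiemannianSubmersion gM gN F)
    (hX : IsHorizontalField E' gM F X)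
    (hZ : IsHorizontalField E' gM F Z) (hV : IsVerticalField E' F V) (x : M) :
    gM.inner x (gM.leviCivita V x (X x)) (Z x) +
      gM.inner x (gM.leviCivita V x (Z x)) (X x) = 0 := by
  -- Symmetry of the second fundamental form trades ∇_X V for ∇_V X. After symmetrising in X and Z,
  -- the right side is the derivative along V of the difference of the scalar products of X, Z and
  -- of F_*X, F_*Z, which agree everywhere.
  have key : ∀ {X Z : ∀ x : M, TangentSpace 𝓘(ℝ, E) x}, IsHorizontalField E' gM F X →
      IsHorizontalField E' gM F Z → gM.inner x (gM.leviCivita V x (X x)) (Z x) =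
      gM.inner x (gM.leviCivita X x (V x)) (Z x) - gN.inner (F x)
        (pullbackCov gN F (fun y ↦ mfderiv 𝓘(ℝ, E) 𝓘(ℝ, E') F y (X y)) x (V x))
        (mfderiv 𝓘(ℝ, E) 𝓘(ℝ, E') F x (Z x)) := by
    intro X Z hX hZ
    have h1 := secondFundamentalForm_symm (gM := gM) (gN := gN) hF.contMDiff hX.1 hV.1 x
    rw [secondFundamentalForm_of_vertical hV] at h1
    rw [← hF.inner_mfderiv _ (hZ.2 x), ← neg_neg (mfderiv 𝓘(ℝ, E) 𝓘(ℝ, E') F x _), h1]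
    unfold secondFundamentalForm
    rw [neg_sub, map_sub, _root_.sub_apply, hF.inner_mfderiv _ (hZ.2 x)]
  rw [key hX hZ, key hZ hX]
  have h2 := mvfderiv_inner_comp gN hF.contMDiff
    ((contMDiffAt_toCoord_mfderiv hF.contMDiff (hX.1 x)).mdifferentiableAt (by simp))
    ((contMDiffAt_toCoord_mfderiv hF.contMDiff (hZ.1 x)).mdifferentiableAt (by simp)) (V x)
  have h3 := gM.mvfderiv_inner (hX.1.mdifferentiableAt x) (hZ.1.mdifferentiableAt x) (V x)
  have h4 : (fun y ↦ gN.inner (F y) (mfderiv 𝓘(ℝ, E) 𝓘(ℝ, E') F y (X y))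
      (mfderiv 𝓘(ℝ, E) 𝓘(ℝ, E') F y (Z y))) = fun y ↦ gM.inner y (X y) (Z y) :=
    funext fun y ↦ hF.isometry y _ _ (hX.2 y) (hZ.2 y)
  rw [h4, h3] at h2
  rw [gN.symm (F x) (pullbackCov gN F (fun y ↦ mfderiv 𝓘(ℝ, E) 𝓘(ℝ, E') F y (Z y)) x (V x)),
    gM.symm x (gM.leviCivita Z x (V x))]
  linarith

end IsSemiRiemannianSubmersion
end Submersion

namespace LorentzianAlmostContact
-- Algebra of the structure and the derivative of ξ
section Contact
variable {E : Type*} [NormedAddCommGroup E] [NormedSpace ℝ E] [FiniteDimensional ℝ E]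
  {M : Type*} [TopologicalSpace M] [ChartedSpace E M] [IsManifold 𝓘(ℝ, E) ∞ M]
  {g : SemiRiemannianMetric E M} {ε : ℝ} (S : LorentzianAlmostContact g ε)
  {X Y Z : ∀ x : M, TangentSpace 𝓘(ℝ, E) x}

theorem isSmoothField_phi (hX : IsSmoothField X) : IsSmoothField (fun x ↦ S.phi x (X x)) :=
  ContMDiff.clm_bundle_apply (F₁ := E) (F₂ := E) (E₁ := (TangentSpace 𝓘(ℝ, E) : M → Type _))
    (E₂ := (TangentSpace 𝓘(ℝ, E) : M → Type _)) (b := fun y ↦ y) S.phi_contMDiff hX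

theorem inner_xi_xi (hε : ε * ε = 1) (x : M) : g.inner x (S.xi x) (S.xi x) = -1 := by
  have h := S.eta_eq x (S.xi x)
  rw [S.eta_xi] at h
  linear_combination (-ε) * h + (-1 - g.inner x (S.xi x) (S.xi x)) * hε

/-- Since φ²ξ = 0, computing φ²(φξ) in two ways shows φξ to be a multiple of ξ. Its scalar square is
g(ξ, ξ) + η(ξ)² = 0 and ξ is timelike, so the multiple is zero. -/
theorem phi_xi (hε : ε * ε = 1) (x : M) : S.phi x (S.xi x) = 0 := by
  have h1 : S.phi x (S.phi x (S.xi x)) = 0 := by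
    rw [S.phi_phi, S.eta_xi, neg_smul, add_neg_cancel]
  have h2 := S.phi_phi x (S.phi x (S.xi x))
  rw [h1, map_zero] at h2
  have h3 : S.phi x (S.xi x) = (-(ε * S.eta x (S.phi x (S.xi x)))) • S.xi x := by
    have := congrArg (fun v ↦ ε • v) h2
    simp only [smul_zero, smul_add, smul_smul, hε, one_smul] at this
    rw [neg_smul]
    exact eq_neg_of_add_eq_zero_left this.symm
  have h4 := S.inner_phi_phi x (S.xi x) (S.xi x)
  rw [S.inner_xi_xi hε, S.eta_xi, h3] at h4
  simp only [map_smul, _root_.smul_apply, smul_eq_mul, S.inner_xi_xi hε] at h4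
  have h5 : (ε * S.eta x (S.phi x (S.xi x))) * (ε * S.eta x (S.phi x (S.xi x))) = 0 := by
    linear_combination (-1) * h4 - hε
  rw [h3, mul_self_eq_zero.1 h5, neg_zero, zero_smul]

/-- Compare φ²(φv) with φ(φ²v), using φξ = 0. -/
theorem eta_phi (hε : ε * ε = 1) (x : M) (v : TangentSpace 𝓘(ℝ, E) x) :
    S.eta x (S.phi x v) = 0 := by
  have h1 := S.phi_phi x (S.phi x v)
  rw [S.phi_phi x v, map_add, map_smul, map_smul, S.phi_xi hε, smul_zero, add_zero,
    left_eq_add] at h1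
  have h2 := congrArg (fun w ↦ g.inner x w (S.xi x)) h1
  simpa [S.inner_xi_xi hε] using h2

theorem inner_xi (hε : ε * ε = 1) (x : M) (v : TangentSpace 𝓘(ℝ, E) x) :
    g.inner x v (S.xi x) = ε * S.eta x v := by
  rw [S.eta_eq]
  linear_combination (-g.inner x v (S.xi x)) * hε

theorem inner_phi_xi (hε : ε * ε = 1) (x : M) (v : TangentSpace 𝓘(ℝ, E) x) :
    g.inner x (S.phi x v) (S.xi x) = 0 := by
  rw [S.inner_xi hε, S.eta_phi hε, mul_zero]

theorem inner_phi_left (hε : ε * ε = 1) (x : M) (v w : TangentSpace 𝓘(ℝ, E) x) :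
    g.inner x (S.phi x v) w = ε * g.inner x v (S.phi x w) := by
  have h1 := S.inner_phi_phi x v (S.phi x w)
  rw [S.eta_phi hε, mul_zero, add_zero, S.phi_phi, map_add, map_smul, map_smul, S.inner_phi_xi hε,
    smul_zero, add_zero, smul_eq_mul] at h1
  linear_combination ε * h1 - g.inner x (S.phi x v) w * hε

variable {S}

theorem IsSasakian.leviCivita_phi [T2Space M] (hS : S.IsSasakian) (hY : IsSmoothField Y) (x : M)
    (v : TangentSpace 𝓘(ℝ, E) x) :
    g.leviCivita (fun y ↦ S.phi y (Y y)) x v = S.phi x (g.leviCivita Y x v) +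
      ((ε * g.inner x (S.phi x v) (S.phi x (Y x))) • S.xi x +
        S.eta x (Y x) • S.phi x (S.phi x v)) := by
  obtain ⟨X, hX, rfl⟩ := exists_isSmoothField_eq x v
  rw [← hS X Y hX hY x, add_sub_cancel]

/-- Differentiating φξ = 0 puts ∇_v ξ - εφv in the kernel of φ; g(ξ, ξ) being constant, it is also
in the kernel of η, where φ² = ε is injective. -/
theorem IsSasakian.leviCivita_xi [T2Space M] (hε : ε * ε = 1) (hS : S.IsSasakian) (x : M)
    (v : TangentSpace 𝓘(ℝ, E) x) : g.leviCivita S.xi x v = ε • S.phi x v := by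
  have h1 := hS.leviCivita_phi S.xi_smooth x v
  have h0 : (fun y ↦ S.phi y (S.xi y)) = 0 := funext fun y ↦ S.phi_xi hε y
  rw [h0, g.leviCivita.zero, S.phi_xi hε, map_zero, mul_zero, zero_smul, zero_add, S.eta_xi,
    Pi.zero_apply, _root_.zero_apply] at h1
  have h2 : S.phi x (g.leviCivita S.xi x v - ε • S.phi x v) = 0 := by
    rw [map_sub, map_smul, sub_eq_add_neg, ← neg_smul]
    exact h1.symm
  have h3 : S.eta x (g.leviCivita S.xi x v - ε • S.phi x v) = 0 := by
    have h4 := g.inner_leviCivita_of_inner_eq_const S.xi_smooth S.xi_smooth (S.inner_xi_xi hε) x v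
    rw [g.symm x (S.xi x)] at h4
    have h5 : g.inner x (g.leviCivita S.xi x v) (S.xi x) = 0 := by linarith
    rw [S.eta_eq, map_sub, map_smul, _root_.sub_apply, _root_.smul_apply, h5, S.inner_phi_xi hε]
    simp
  have h6 := S.phi_phi x (g.leviCivita S.xi x v - ε • S.phi x v)
  rw [h2, h3, map_zero, zero_smul, add_zero] at h6
  have hε0 : ε ≠ 0 := left_ne_zero_of_mul_eq_one hε
  exact sub_eq_zero.1 ((smul_eq_zero.1 h6.symm).resolve_left hε0)

end Contact

/-! ### Anti-invariant submersions, and the para Sasakian case -/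

section Submersion
variable {E : Type*} [NormedAddCommGroup E] [NormedSpace ℝ E] [FiniteDimensional ℝ E]
  {M : Type*} [TopologicalSpace M] [T2Space M] [ChartedSpace E M] [IsManifold 𝓘(ℝ, E) ∞ M]
  {E' : Type*} [NormedAddCommGroup E'] [NormedSpace ℝ E'] [FiniteDimensional ℝ E']
  {N : Type*} [TopologicalSpace N] [ChartedSpace E' N] [IsManifold 𝓘(ℝ, E') ∞ N]
  {g : SemiRiemannianMetric E M} {gN : SemiRiemannianMetric E' N} {F : M → N}
  {ε : ℝ} {S : LorentzianAlmostContact g ε} {X Y Z V W : ∀ x : M, TangentSpace 𝓘(ℝ, E) x}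

theorem eta_vertical (hxi : ∀ x, S.xi x ∈ horizontal E' g F x) {x : M} {v : TangentSpace 𝓘(ℝ, E) x}
    (hv : v ∈ vertical E E' F x) : S.eta x v = 0 := by
  rw [S.eta_eq, inner_eq_zero_of_vertical_of_horizontal hv (hxi x), mul_zero]

theorem IsAntiInvariant.isHorizontalField_phi (hanti : S.IsAntiInvariant E' F)
    (hV : IsVerticalField E' F V) : IsHorizontalField E' g F (fun x ↦ S.phi x (V x)) :=
  ⟨S.isSmoothField_phi hV.1, fun x ↦ hanti x _ (hV.2 x)⟩

/-- The derivative of `φ W` for vertical `W`, tested against vectors orthogonal to `ξ`. -/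
theorem IsSasakian.inner_leviCivita_phi (hS : S.IsSasakian)
    (hxi : ∀ x, S.xi x ∈ horizontal E' g F x) (hW : IsVerticalField E' F W) (x : M)
    (v u : TangentSpace 𝓘(ℝ, E) x) (hu : g.inner x u (S.xi x) = 0) :
    g.inner x u (g.leviCivita (fun y ↦ S.phi y (W y)) x v) =
      g.inner x u (S.phi x (g.leviCivita W x v)) := by
  -- As η(W) = 0, the term (∇_v φ)W is a multiple of ξ.
  rw [hS.leviCivita_phi hW.1, map_add, map_add, map_smul, map_smul, hu,
    eta_vertical hxi (hW.2 x), zero_smul, smul_zero, add_zero, add_zero]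

/-- The scalar products of `φ (ker F_*)` with the derivatives of vertical fields are symmetric
up to `-ε`. -/
theorem IsSasakian.inner_leviCivita_phi_swap (hε : ε * ε = 1) (hS : S.IsSasakian)
    (hanti : S.IsAntiInvariant E' F) (hxi : ∀ x, S.xi x ∈ horizontal E' g F x)
    (hV : IsVerticalField E' F V) (hW : IsVerticalField E' F W) (x : M)
    (v : TangentSpace 𝓘(ℝ, E) x) :
    g.inner x (g.leviCivita V x v) (S.phi x (W x)) =
      -(ε * g.inner x (g.leviCivita W x v) (S.phi x (V x))) := by
  rw [g.inner_leviCivita_of_inner_eq_const hV.1 (S.isSmoothField_phi hW.1)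
    (fun y ↦ inner_eq_zero_of_vertical_of_horizontal (hV.2 y) (hanti y _ (hW.2 y))),
    hS.inner_leviCivita_phi hxi hW x v _
      (inner_eq_zero_of_vertical_of_horizontal (hV.2 x) (hxi x)),
    g.symm x (V x), S.inner_phi_left hε]

/-- A para Sasakian manifold has no anti-invariant submersion with horizontal `ξ` and nontrivial
fibres. -/
theorem IsSasakian.vertical_eq_zero (S : LorentzianAlmostContact g (1 : ℝ)) (hS : S.IsSasakian)
    (hF : IsSemiRiemannianSubmersion g gN F) (hanti : S.IsAntiInvariant E' F)
    (hxi : ∀ x, S.xi x ∈ horizontal E' g F x) {x : M} {v : TangentSpace 𝓘(ℝ, E) x}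
    (hv : v ∈ vertical E E' F x) : v = 0 := by
  have hε : (1 : ℝ) * 1 = 1 := one_mul 1
  have key : ∀ {V W : ∀ x : M, TangentSpace 𝓘(ℝ, E) x}, IsVerticalField E' F V →
      IsVerticalField E' F W →
      g.inner x (g.leviCivita V x (S.xi x)) (S.phi x (W x)) = g.inner x (V x) (W x) := by
    intro V W hV hW
    -- Alternation moves the derivative onto ξ: g(∇_ξ V, φW) = g(V, ∇_{φW} ξ) = g(V, φ²W).
    have h1 := hF.inner_leviCivita_vertical ⟨S.xi_smooth, hxi⟩ (hanti.isHorizontalField_phi hW) hV x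
    rw [g.inner_leviCivita_of_inner_eq_const hV.1 S.xi_smooth
      (fun y ↦ inner_eq_zero_of_vertical_of_horizontal (hV.2 y) (hxi y)) x (S.phi x (W x)),
      hS.leviCivita_xi hε, S.phi_phi, eta_vertical hxi (hW.2 x)] at h1
    simp only [one_smul, zero_smul, add_zero] at h1
    linarith
  refine hF.fibre_nondegenerate x v hv fun w hw ↦ ?_
  obtain ⟨V, hV, rfl⟩ := hF.exists_isVerticalField_eq hv
  obtain ⟨W, hW, rfl⟩ := hF.exists_isVerticalField_eq hw
  -- For ε = 1 the swap is antisymmetric, against the symmetric value given by `key`.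
  have h1 := hS.inner_leviCivita_phi_swap hε hanti hxi hV hW x (S.xi x)
  rw [key hV hW, key hW hV, g.symm x (W x)] at h1
  linarith

/-! ### The second fundamental form of `F` -/

theorem inner_secondFundamentalForm (hF : IsSemiRiemannianSubmersion g gN F)
    (hanti : S.IsAntiInvariant E' F) (hX : IsSmoothField X)
    (hV : IsVerticalField E' F V) (hW : IsVerticalField E' F W) (x : M) :
    gN.inner (F x) (secondFundamentalForm g gN F V X x)
      (mfderiv 𝓘(ℝ, E) 𝓘(ℝ, E') F x (S.phi x (W x))) =
      -g.inner x (g.leviCivita V x (X x)) (S.phi x (W x)) := by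
  rw [secondFundamentalForm_symm hF.contMDiff hV.1 hX, secondFundamentalForm_of_vertical hV,
    map_neg, _root_.neg_apply, hF.inner_mfderiv _ (hanti x _ (hW.2 x))]

theorem tensorT_add_tensorA_mem_mu_iff (hF : IsSemiRiemannianSubmersion g gN F)
    (hanti : S.IsAntiInvariant E' F) (hX : IsSmoothField X) (hV : IsVerticalField E' F V) (x : M) :
    hF.tensorT V (S.fieldB hF X) x + hF.tensorA (S.fieldC hF X) V x ∈ S.mu E' F x ↔
      ∀ w ∈ vertical E E' F x,
        g.inner x (g.leviCivita V x (S.phi x (X x))) (S.phi x w) = 0 := by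
  have hB : IsVerticalField E' F (S.fieldB hF X) :=
    ⟨hF.isSmoothField_verticalPart (S.isSmoothField_phi hX), fun y ↦ hF.verticalPart_mem _⟩
  have hT : hF.tensorT V (S.fieldB hF X) x =
      hF.horizontalPart x (g.leviCivita (S.fieldB hF X) x (V x)) := by
    unfold IsSemiRiemannianSubmersion.tensorT
    have h1 : (fun y ↦ hF.verticalPart y (S.fieldB hF X y)) = S.fieldB hF X :=
      funext fun y ↦ hF.verticalPart_of_mem (hB.2 y)
    have h2 : (fun y ↦ hF.horizontalPart y (S.fieldB hF X y)) = 0 :=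
      funext fun y ↦ hF.horizontalPart_of_vertical (hB.2 y)
    rw [h1, h2, g.leviCivita.zero, hF.verticalPart_of_mem (hV.2 x)]
    simp
  have hA : hF.tensorA (S.fieldC hF X) V x =
      hF.horizontalPart x (g.leviCivita V x (S.fieldC hF X x)) := by
    unfold IsSemiRiemannianSubmersion.tensorA
    have h1 : (fun y ↦ hF.verticalPart y (V y)) = V :=
      funext fun y ↦ hF.verticalPart_of_mem (hV.2 y)
    have h2 : (fun y ↦ hF.horizontalPart y (V y)) = 0 :=
      funext fun y ↦ hF.horizontalPart_of_vertical (hV.2 y)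
    rw [h1, h2, g.leviCivita.zero,
      hF.horizontalPart_of_mem (v := S.fieldC hF X x) (hF.horizontalPart_mem _)]
    simp
  -- Because [V, BX] is vertical, ℋ∇_V BX = ℋ∇_{BX} V, and the two terms combine through BX + CX =
  -- φX.
  have hsum : hF.tensorT V (S.fieldB hF X) x + hF.tensorA (S.fieldC hF X) V x =
      hF.horizontalPart x (g.leviCivita V x (S.phi x (X x))) := by
    have h1 := hF.mlieBracket_mem_vertical hV hB x
    rw [g.mlieBracket_eq hV.1 hB.1] at h1
    have h2 := hF.horizontalPart_of_vertical h1
    rw [map_sub, sub_eq_zero] at h2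
    rw [hT, hA, h2, ← map_add, ← map_add, S.fieldB_add_fieldC]
  have hinner : ∀ w ∈ vertical E E' F x,
      g.inner x (S.phi x w) (hF.horizontalPart x (g.leviCivita V x (S.phi x (X x)))) =
        g.inner x (g.leviCivita V x (S.phi x (X x))) (S.phi x w) := by
    intro w hw
    rw [g.symm, hF.inner_horizontalPart, hF.inner_mfderiv _ (hanti x w hw)]
  rw [hsum]
  constructor
  · intro h w hw
    rw [← hinner w hw]
    exact h.2 _ ⟨w, hw, rfl⟩
  · intro h
    refine ⟨hF.horizontalPart_mem _, ?_⟩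
    rintro _ ⟨w, hw, rfl⟩
    exact (hinner w hw).trans (h w hw)

end Submersion
open VectorField

/-! ### The Sasakian case: symmetries generated by ξ -/

section Sasakian
variable {E : Type*} [NormedAddCommGroup E] [NormedSpace ℝ E] [FiniteDimensional ℝ E]
  {M : Type*} [TopologicalSpace M] [T2Space M] [ChartedSpace E M] [IsManifold 𝓘(ℝ, E) ∞ M]
  {g : SemiRiemannianMetric E M} {S : LorentzianAlmostContact g (-1 : ℝ)}
  {X Y Z V W : ∀ x : M, TangentSpace 𝓘(ℝ, E) x}

theorem phi_phi_of_eta_eq_zero {x : M} {v : TangentSpace 𝓘(ℝ, E) x} (hv : S.eta x v = 0) :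
    S.phi x (S.phi x v) = -v := by
  rw [S.phi_phi, hv, zero_smul, add_zero, neg_one_smul]

theorem inner_phi_left_neg (x : M) (v w : TangentSpace 𝓘(ℝ, E) x) :
    g.inner x (S.phi x v) w = -g.inner x v (S.phi x w) := by
  rw [S.inner_phi_left (by norm_num), neg_one_mul]

theorem IsSasakian.leviCivita_xi_eq_neg (hS : S.IsSasakian) (x : M)
    (v : TangentSpace 𝓘(ℝ, E) x) : g.leviCivita S.xi x v = -S.phi x v := by
  rw [hS.leviCivita_xi (by norm_num), neg_one_smul]

/-- The characteristic field of a Sasakian structure preserves `φ`. -/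
theorem IsSasakian.mlieBracket_xi_phi (hS : S.IsSasakian) (hY : IsSmoothField Y) (x : M) :
    mlieBracket 𝓘(ℝ, E) S.xi (fun y ↦ S.phi y (Y y)) x =
      S.phi x (mlieBracket 𝓘(ℝ, E) S.xi Y x) := by
  -- Here (∇_ξ φ)Y = 0 because φξ = 0, and ∇ξ = -φ commutes with φ.
  rw [g.mlieBracket_eq S.xi_smooth (S.isSmoothField_phi hY), g.mlieBracket_eq S.xi_smooth hY,
    hS.leviCivita_phi hY, hS.leviCivita_xi_eq_neg, hS.leviCivita_xi_eq_neg,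
    S.phi_xi (by norm_num)]
  simp

/-- The characteristic field of a Sasakian structure is a Killing field. -/
theorem IsSasakian.mvfderiv_inner_xi (hS : S.IsSasakian) (hY : IsSmoothField Y)
    (hZ : IsSmoothField Z) (x : M) :
    mvfderiv 𝓘(ℝ, E) (fun y ↦ g.inner y (Y y) (Z y)) x (S.xi x) =
      g.inner x (mlieBracket 𝓘(ℝ, E) S.xi Y x) (Z x) +
        g.inner x (Y x) (mlieBracket 𝓘(ℝ, E) S.xi Z x) := by
  -- The Killing property is the skew-symmetry of ∇ξ = -φ.
  rw [g.mvfderiv_inner (hY.mdifferentiableAt x) (hZ.mdifferentiableAt x),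
    g.mlieBracket_eq S.xi_smooth hY, g.mlieBracket_eq S.xi_smooth hZ, hS.leviCivita_xi_eq_neg,
    hS.leviCivita_xi_eq_neg]
  simp only [map_sub, map_neg, _root_.sub_apply, _root_.neg_apply, inner_phi_left_neg]
  ring

theorem IsSasakian.inner_mlieBracket_xi_of_inner_eq_zero (hS : S.IsSasakian) (hY : IsSmoothField Y)
    (hZ : IsSmoothField Z) (h : ∀ x, g.inner x (Y x) (Z x) = 0) (x : M) :
    g.inner x (mlieBracket 𝓘(ℝ, E) S.xi Y x) (Z x) =
      -g.inner x (Y x) (mlieBracket 𝓘(ℝ, E) S.xi Z x) := by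
  have h1 := hS.mvfderiv_inner_xi hY hZ x
  simp only [h] at h1
  rw [mvfderiv_const, _root_.zero_apply] at h1
  linarith

end Sasakian

/-! ### Lie derivatives along ξ of vertical fields and of sections of μ -/

section Submersion
variable {E : Type*} [NormedAddCommGroup E] [NormedSpace ℝ E] [FiniteDimensional ℝ E]
  {M : Type*} [TopologicalSpace M] [T2Space M] [ChartedSpace E M] [IsManifold 𝓘(ℝ, E) ∞ M]
  {E' : Type*} [NormedAddCommGroup E'] [NormedSpace ℝ E'] [FiniteDimensional ℝ E']
  {N : Type*} [TopologicalSpace N] [ChartedSpace E' N] [IsManifold 𝓘(ℝ, E') ∞ N]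
  {g : SemiRiemannianMetric E M} {gN : SemiRiemannianMetric E' N} {F : M → N}
  {S : LorentzianAlmostContact g (-1 : ℝ)} {X Y Z V W : ∀ x : M, TangentSpace 𝓘(ℝ, E) x}

/-- `F` is an anti-invariant semi-Riemannian submersion with horizontal `ξ` of a Lorentzian Sasakian
manifold. -/
structure IsSasakianSubmersion (S : LorentzianAlmostContact g (-1 : ℝ))
    (gN : SemiRiemannianMetric E' N) (F : M → N) : Prop where
  sasakian : S.IsSasakian
  submersion : IsSemiRiemannianSubmersion g gN F
  antiInvariant : S.IsAntiInvariant E' F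
  xi_mem (x : M) : S.xi x ∈ horizontal E' g F x

/-- `Y` is a smooth section of the orthogonal complement of `ξ` in `μ`. -/
structure IsMuField (E' : Type*) [NormedAddCommGroup E'] [NormedSpace ℝ E'] {N : Type*}
    [TopologicalSpace N] [ChartedSpace E' N] (S : LorentzianAlmostContact g (-1 : ℝ)) (F : M → N)
    (Y : ∀ x : M, TangentSpace 𝓘(ℝ, E) x) : Prop where
  isHorizontalField : IsHorizontalField E' g F Y
  phi_mem (x : M) : S.phi x (Y x) ∈ horizontal E' g F x
  eta_eq_zero (x : M) : S.eta x (Y x) = 0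

/-- The vertical part `[ξ, V] - 2 φ V` of the Lie derivative of a vertical field `V` along `ξ`. -/
def verticalLie (S : LorentzianAlmostContact g (-1 : ℝ)) (V : ∀ x : M, TangentSpace 𝓘(ℝ, E) x)
    (x : M) : TangentSpace 𝓘(ℝ, E) x :=
  mlieBracket 𝓘(ℝ, E) S.xi V x - (2 : ℝ) • S.phi x (V x)

theorem mlieBracket_xi_eq (V : ∀ x : M, TangentSpace 𝓘(ℝ, E) x) (x : M) :
    mlieBracket 𝓘(ℝ, E) S.xi V x = S.verticalLie V x + (2 : ℝ) • S.phi x (V x) :=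
  (sub_add_cancel _ _).symm

theorem IsMuField.phi (hY : IsMuField E' S F Y) : IsMuField E' S F (fun x ↦ S.phi x (Y x)) where
  isHorizontalField := ⟨S.isSmoothField_phi hY.isHorizontalField.1, hY.phi_mem⟩
  phi_mem x := by
    rw [phi_phi_of_eta_eq_zero (hY.eta_eq_zero x)]
    exact Submodule.neg_mem _ (hY.isHorizontalField.2 x)
  eta_eq_zero x := S.eta_phi (by norm_num) x _

theorem IsMuField.inner_xi (hY : IsMuField E' S F Y) (x : M) : g.inner x (Y x) (S.xi x) = 0 := by
  rw [S.inner_xi (by norm_num), hY.eta_eq_zero, mul_zero]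

theorem IsMuField.inner_phi_vertical (hY : IsMuField E' S F Y) {x : M}
    {v : TangentSpace 𝓘(ℝ, E) x} (hv : v ∈ vertical E E' F x) :
    g.inner x (Y x) (S.phi x v) = 0 := by
  rw [← neg_eq_zero, ← inner_phi_left_neg,
    inner_eq_zero_of_horizontal_of_vertical (hY.phi_mem x) hv]

namespace IsSasakianSubmersion

theorem eta_vertical (h : IsSasakianSubmersion S gN F) {x : M} {v : TangentSpace 𝓘(ℝ, E) x}
    (hv : v ∈ vertical E E' F x) : S.eta x v = 0 :=
  LorentzianAlmostContact.eta_vertical h.xi_mem hv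

/-- Against a horizontal Z, both g(∇_ξ V, Z), by alternation, and -g(∇_V ξ, Z) equal g(φV, Z); this
is where the factor 2 comes from. -/
theorem isVerticalField_verticalLie (h : IsSasakianSubmersion S gN F)
    (hV : IsVerticalField E' F V) : IsVerticalField E' F (S.verticalLie V) := by
  have := FiniteDimensional.complete ℝ E
  refine ⟨(S.xi_smooth.mlieBracket hV.1).sub ((S.isSmoothField_phi hV.1).const_smul 2),
    fun x ↦ h.submersion.mem_vertical_of_inner fun w hw ↦ ?_⟩
  obtain ⟨Z, hZ, rfl⟩ := h.submersion.exists_isHorizontalField_eq hw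
  have h1 := h.submersion.inner_leviCivita_vertical ⟨S.xi_smooth, h.xi_mem⟩ hZ hV x
  rw [g.inner_leviCivita_of_inner_eq_const hV.1 S.xi_smooth
    (fun y ↦ inner_eq_zero_of_vertical_of_horizontal (hV.2 y) (h.xi_mem y)),
    h.sasakian.leviCivita_xi_eq_neg] at h1
  unfold verticalLie
  rw [g.mlieBracket_eq S.xi_smooth hV.1, h.sasakian.leviCivita_xi_eq_neg]
  simp only [map_sub, map_neg, map_smul, _root_.sub_apply, _root_.neg_apply, _root_.smul_apply,
    smul_eq_mul, inner_phi_left_neg, neg_neg] at h1 ⊢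
  linarith

theorem mlieBracket_xi_phi_vertical (h : IsSasakianSubmersion S gN F)
    (hW : IsVerticalField E' F W) :
    mlieBracket 𝓘(ℝ, E) S.xi (fun y ↦ S.phi y (W y)) =
      (fun y ↦ S.phi y (S.verticalLie W y)) + (-2 : ℝ) • W := by
  ext1 x
  rw [h.sasakian.mlieBracket_xi_phi hW.1, mlieBracket_xi_eq, map_add, map_smul,
    phi_phi_of_eta_eq_zero (h.eta_vertical (hW.2 x))]
  simp

/-- As ξ is Killing, g([ξ, Y], V) = -g(Y, [ξ, V]), and [ξ, V] lies in ker F_* + φ(ker F_*),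
orthogonal to Y. The same applies to φY, since ξ preserves φ. -/
theorem isMuField_mlieBracket_xi (h : IsSasakianSubmersion S gN F) (hY : IsMuField E' S F Y) :
    IsMuField E' S F (mlieBracket 𝓘(ℝ, E) S.xi Y) := by
  have := FiniteDimensional.complete ℝ E
  have key : ∀ {Y : ∀ x : M, TangentSpace 𝓘(ℝ, E) x}, IsMuField E' S F Y → ∀ x,
      mlieBracket 𝓘(ℝ, E) S.xi Y x ∈ horizontal E' g F x := by
    intro Y hY x v hv
    obtain ⟨V, hV, rfl⟩ := h.submersion.exists_isVerticalField_eq hv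
    change g.inner x (V x) (mlieBracket 𝓘(ℝ, E) S.xi Y x) = 0
    rw [g.symm, h.sasakian.inner_mlieBracket_xi_of_inner_eq_zero hY.isHorizontalField.1 hV.1
      (fun y ↦ inner_eq_zero_of_horizontal_of_vertical (hY.isHorizontalField.2 y) (hV.2 y)),
      mlieBracket_xi_eq, map_add, map_smul, hY.inner_phi_vertical (hV.2 x),
      inner_eq_zero_of_horizontal_of_vertical (hY.isHorizontalField.2 x)
        ((h.isVerticalField_verticalLie hV).2 x)]
    simp
  refine ⟨⟨S.xi_smooth.mlieBracket hY.isHorizontalField.1, key hY⟩, fun x ↦ ?_, fun x ↦ ?_⟩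
  · rw [← h.sasakian.mlieBracket_xi_phi hY.isHorizontalField.1]
    exact key hY.phi x
  · rw [S.eta_eq, h.sasakian.inner_mlieBracket_xi_of_inner_eq_zero hY.isHorizontalField.1
      S.xi_smooth hY.inner_xi, mlieBracket_self]
    simp

/-! ### The pairings of `φ (ker F_*)` with brackets -/

/-- This is the pairing k. The two halves of the bracket contribute equally, by alternation of 𝒜. -/
theorem inner_mlieBracket_phi (h : IsSasakianSubmersion S gN F) (hY : IsHorizontalField E' g F Y)
    (hV : IsVerticalField E' F V) (hW : IsVerticalField E' F W) (x : M) :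
    g.inner x (V x) (mlieBracket 𝓘(ℝ, E) Y (fun y ↦ S.phi y (W y)) x) =
      -2 * g.inner x (g.leviCivita V x (Y x)) (S.phi x (W x)) := by
  have hφ := h.antiInvariant.isHorizontalField_phi hW
  have h1 := h.submersion.inner_leviCivita_vertical hY hφ hV x
  have h2 := g.inner_leviCivita_of_inner_eq_const hV.1 hφ.1
    (fun y ↦ inner_eq_zero_of_vertical_of_horizontal (hV.2 y) (hφ.2 y)) x (Y x)
  have h3 := g.inner_leviCivita_of_inner_eq_const hV.1 hY.1
    (fun y ↦ inner_eq_zero_of_vertical_of_horizontal (hV.2 y) (hY.2 y)) x (S.phi x (W x))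
  rw [g.mlieBracket_eq hY.1 hφ.1, map_sub]
  linarith

/-- This is the pairing l; differentiating g(Y, φW) = 0 along V produces the term τ(φY). -/
theorem inner_mlieBracket_vertical (h : IsSasakianSubmersion S gN F) (hY : IsMuField E' S F Y)
    (hV : IsVerticalField E' F V) (hW : IsVerticalField E' F W) (x : M) :
    g.inner x (mlieBracket 𝓘(ℝ, E) V Y x) (S.phi x (W x)) =
      g.inner x (g.leviCivita W x (V x)) (S.phi x (Y x)) -
        g.inner x (g.leviCivita V x (Y x)) (S.phi x (W x)) := by
  have h1 := g.inner_leviCivita_of_inner_eq_const hY.isHorizontalField.1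
    (S.isSmoothField_phi hW.1) (fun y ↦ hY.inner_phi_vertical (hW.2 y)) x (V x)
  rw [h.sasakian.inner_leviCivita_phi h.xi_mem hW x _ _ (hY.inner_xi x)] at h1
  rw [g.mlieBracket_eq hV.1 hY.isHorizontalField.1, map_sub, _root_.sub_apply, h1, g.symm x (Y x),
    inner_phi_left_neg, neg_neg]

theorem inner_leviCivita_symm (h : IsSasakianSubmersion S gN F) (hY : IsHorizontalField E' g F Y)
    (hV : IsVerticalField E' F V) (hW : IsVerticalField E' F W) (x : M) :
    g.inner x (g.leviCivita W x (V x)) (Y x) = g.inner x (g.leviCivita V x (W x)) (Y x) := by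
  have h1 := h.submersion.mlieBracket_mem_vertical hV hW x
  rw [g.mlieBracket_eq hV.1 hW.1] at h1
  have h2 := inner_eq_zero_of_vertical_of_horizontal h1 (hY.2 x)
  rw [map_sub, _root_.sub_apply] at h2
  linarith

theorem inner_leviCivita_phi_symm (h : IsSasakianSubmersion S gN F)
    (hV : IsVerticalField E' F V) (hW : IsVerticalField E' F W) (x : M)
    (v : TangentSpace 𝓘(ℝ, E) x) :
    g.inner x (g.leviCivita V x v) (S.phi x (W x)) =
      g.inner x (g.leviCivita W x v) (S.phi x (V x)) := by
  rw [h.sasakian.inner_leviCivita_phi_swap (by norm_num) h.antiInvariant h.xi_mem hV hW]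
  ring

/-- The value α(φY) - τ(Y) of the extra term in the ξ-derivatives of k and l. The ∇_Y parts cancel
because φ is isometric on vectors with η = 0. -/
theorem inner_phi_mlieBracket_sub (h : IsSasakianSubmersion S gN F) (hY : IsMuField E' S F Y)
    (hV : IsVerticalField E' F V) (hW : IsVerticalField E' F W) (x : M) :
    g.inner x (S.phi x (V x)) (mlieBracket 𝓘(ℝ, E) Y (fun y ↦ S.phi y (W y)) x) -
        g.inner x (V x) (mlieBracket 𝓘(ℝ, E) Y W x) =
      g.inner x (g.leviCivita V x (S.phi x (Y x))) (S.phi x (W x)) -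
        g.inner x (g.leviCivita W x (V x)) (Y x) := by
  have hYh := hY.isHorizontalField
  have hφW := h.antiInvariant.isHorizontalField_phi hW
  have hφV := h.antiInvariant.isHorizontalField_phi hV
  have hφVxi : g.inner x (S.phi x (V x)) (S.xi x) = 0 := S.inner_phi_xi (by norm_num) x _
  have h1 : g.inner x (S.phi x (V x)) (g.leviCivita (fun y ↦ S.phi y (W y)) x (Y x)) =
      g.inner x (V x) (g.leviCivita W x (Y x)) := by
    rw [h.sasakian.inner_leviCivita_phi h.xi_mem hW x _ _ hφVxi, S.inner_phi_phi,
      h.eta_vertical (hV.2 x), zero_mul, add_zero]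
  have h2 := g.inner_leviCivita_of_inner_eq_const hYh.1 hφV.1
    (fun y ↦ hY.inner_phi_vertical (hV.2 y)) x (S.phi x (W x))
  rw [h.sasakian.inner_leviCivita_phi h.xi_mem hV x _ _ (hY.inner_xi x)] at h2
  have h3 := h.submersion.inner_leviCivita_vertical hφW hY.phi.isHorizontalField hV x
  have h4 := g.inner_leviCivita_of_inner_eq_const hV.1 hYh.1
    (fun y ↦ inner_eq_zero_of_vertical_of_horizontal (hV.2 y) (hYh.2 y)) x (W x)
  have h5 := h.inner_leviCivita_symm hYh hV hW x
  have h6 := inner_phi_left_neg (S := S) x (Y x) (g.leviCivita V x (S.phi x (W x)))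
  rw [g.symm x (S.phi x (Y x))] at h6
  rw [g.mlieBracket_eq hYh.1 hφW.1, g.mlieBracket_eq hYh.1 hW.1, map_sub, map_sub, h1,
    g.symm x (S.phi x (V x)), h2]
  linarith

/-- Leibniz rule for the Killing field ξ together with the Jacobi identity. The last term collects
2φV from [ξ, V] and -2W from [ξ, φW]. -/
theorem mvfderiv_inner_mlieBracket_phi (h : IsSasakianSubmersion S gN F) (hY : IsMuField E' S F Y)
    (hV : IsVerticalField E' F V) (hW : IsVerticalField E' F W) (x : M) :
    mvfderiv 𝓘(ℝ, E) (fun y ↦ g.inner y (V y) (mlieBracket 𝓘(ℝ, E) Y (fun z ↦ S.phi z (W z)) y)) x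
        (S.xi x) =
      g.inner x (S.verticalLie V x) (mlieBracket 𝓘(ℝ, E) Y (fun z ↦ S.phi z (W z)) x) +
      g.inner x (V x) (mlieBracket 𝓘(ℝ, E) (mlieBracket 𝓘(ℝ, E) S.xi Y)
        (fun z ↦ S.phi z (W z)) x) +
      g.inner x (V x) (mlieBracket 𝓘(ℝ, E) Y (fun z ↦ S.phi z (S.verticalLie W z)) x) +
      2 * (g.inner x (S.phi x (V x)) (mlieBracket 𝓘(ℝ, E) Y (fun y ↦ S.phi y (W y)) x) -
        g.inner x (V x) (mlieBracket 𝓘(ℝ, E) Y W x)) := by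
  have := FiniteDimensional.complete ℝ E
  have hYs := hY.isHorizontalField.1
  have hφW := S.isSmoothField_phi hW.1
  have hDW := S.isSmoothField_phi (h.isVerticalField_verticalLie hW).1
  have h2W : IsSmoothField ((-2 : ℝ) • W) := hW.1.const_smul (-2)
  rw [h.sasakian.mvfderiv_inner_xi hV.1 (hYs.mlieBracket hφW),
    S.xi_smooth.leibniz_identity hYs hφW, h.mlieBracket_xi_phi_vertical hW,
    mlieBracket_add_right (hDW.mdifferentiableAt x) (h2W.mdifferentiableAt x),
    mlieBracket_const_smul_right (hW.1.mdifferentiableAt x), mlieBracket_xi_eq V]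
  simp only [map_add, map_smul, _root_.add_apply, _root_.smul_apply, smul_eq_mul]
  ring

/-- The same computation for l; the extra term has the opposite sign and V, W exchanged. -/
theorem mvfderiv_inner_mlieBracket_vertical (h : IsSasakianSubmersion S gN F)
    (hY : IsMuField E' S F Y) (hV : IsVerticalField E' F V) (hW : IsVerticalField E' F W) (x : M) :
    mvfderiv 𝓘(ℝ, E) (fun y ↦ g.inner y (mlieBracket 𝓘(ℝ, E) V Y y) (S.phi y (W y))) x (S.xi x) =
      g.inner x (mlieBracket 𝓘(ℝ, E) (S.verticalLie V) Y x) (S.phi x (W x)) +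
      g.inner x (mlieBracket 𝓘(ℝ, E) V (mlieBracket 𝓘(ℝ, E) S.xi Y) x) (S.phi x (W x)) +
      g.inner x (mlieBracket 𝓘(ℝ, E) V Y x) (S.phi x (S.verticalLie W x)) -
      2 * (g.inner x (S.phi x (W x)) (mlieBracket 𝓘(ℝ, E) Y (fun y ↦ S.phi y (V y)) x) -
        g.inner x (W x) (mlieBracket 𝓘(ℝ, E) Y V x)) := by
  have := FiniteDimensional.complete ℝ E
  have hYs := hY.isHorizontalField.1
  have hφV := S.isSmoothField_phi hV.1
  have hDV := (h.isVerticalField_verticalLie hV).1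
  have h2V : IsSmoothField ((2 : ℝ) • fun y ↦ S.phi y (V y)) := hφV.const_smul 2
  have hbr : mlieBracket 𝓘(ℝ, E) S.xi V =
      S.verticalLie V + (2 : ℝ) • (fun y ↦ S.phi y (V y)) := funext (mlieBracket_xi_eq V)
  rw [h.sasakian.mvfderiv_inner_xi (hV.1.mlieBracket hYs) (S.isSmoothField_phi hW.1),
    S.xi_smooth.leibniz_identity hV.1 hYs, h.mlieBracket_xi_phi_vertical hW, hbr,
    mlieBracket_add_left (hDV.mdifferentiableAt x) (h2V.mdifferentiableAt x),
    mlieBracket_const_smul_left (hφV.mdifferentiableAt x),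
    mlieBracket_swap_apply (V := Y) (W := V), mlieBracket_swap_apply (V := Y)
      (W := fun y ↦ S.phi y (V y)), g.symm x (S.phi x (W x)), g.symm x (W x)]
  simp only [map_add, map_smul, map_neg, _root_.add_apply, _root_.smul_apply, _root_.neg_apply,
    smul_eq_mul, Pi.add_apply, Pi.smul_apply]
  ring

/-- If `φ (ker F_*)` is orthogonal to the derivatives of vertical fields along `μ`, then the
second fundamental form of the fibres has no component in `μ`. -/
theorem inner_leviCivita_eq_zero_of_mu (h : IsSasakianSubmersion S gN F)
    (hα : ∀ Y V W : ∀ x : M, TangentSpace 𝓘(ℝ, E) x, IsMuField E' S F Y → IsVerticalField E' F V →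
      IsVerticalField E' F W → ∀ x, g.inner x (g.leviCivita V x (Y x)) (S.phi x (W x)) = 0)
    (hY : IsMuField E' S F Y) (hV : IsVerticalField E' F V) (hW : IsVerticalField E' F W) (x : M) :
    g.inner x (g.leviCivita W x (V x)) (Y x) = 0 := by
  have hk : ∀ {Y V W : ∀ x : M, TangentSpace 𝓘(ℝ, E) x}, IsMuField E' S F Y →
      IsVerticalField E' F V → IsVerticalField E' F W → ∀ x,
      g.inner x (V x) (mlieBracket 𝓘(ℝ, E) Y (fun y ↦ S.phi y (W y)) x) = 0 := by
    intro Y V W hY hV hW x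
    rw [h.inner_mlieBracket_phi hY.isHorizontalField hV hW, hα Y V W hY hV hW, mul_zero]
  have h1 := h.mvfderiv_inner_mlieBracket_phi hY hV hW x
  rw [hk hY (h.isVerticalField_verticalLie hV) hW, hk (h.isMuField_mlieBracket_xi hY) hV hW,
    hk hY hV (h.isVerticalField_verticalLie hW), h.inner_phi_mlieBracket_sub hY hV hW,
    hα _ V W hY.phi hV hW, funext (hk hY hV hW), mvfderiv_const, _root_.zero_apply] at h1
  -- Every k vanishes, and so does α(φY), so `h1` reads 0 = 2(0 - τ(Y)).
  linarith

/-- If the second fundamental form of the fibres has no component in `μ`, then `φ (ker F_*)` is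
orthogonal to the derivatives of vertical fields along `μ`. -/
theorem inner_leviCivita_mu_eq_zero (h : IsSasakianSubmersion S gN F)
    (hτ : ∀ Y V W : ∀ x : M, TangentSpace 𝓘(ℝ, E) x, IsMuField E' S F Y → IsVerticalField E' F V →
      IsVerticalField E' F W → ∀ x, g.inner x (g.leviCivita W x (V x)) (Y x) = 0)
    (hY : IsMuField E' S F Y) (hV : IsVerticalField E' F V) (hW : IsVerticalField E' F W) (x : M) :
    g.inner x (g.leviCivita V x (Y x)) (S.phi x (W x)) = 0 := by
  have := FiniteDimensional.complete ℝ E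
  -- With τ = 0 the pairings are k = -2α and l = -α; the sum l + l lets the derivative be split by
  -- additivity.
  have hkl : ∀ {Y V W : ∀ x : M, TangentSpace 𝓘(ℝ, E) x}, IsMuField E' S F Y →
      IsVerticalField E' F V → IsVerticalField E' F W → ∀ x,
      g.inner x (V x) (mlieBracket 𝓘(ℝ, E) Y (fun y ↦ S.phi y (W y)) x) =
        g.inner x (mlieBracket 𝓘(ℝ, E) V Y x) (S.phi x (W x)) +
        g.inner x (mlieBracket 𝓘(ℝ, E) V Y x) (S.phi x (W x)) := by
    intro Y V W hY hV hW x
    rw [h.inner_mlieBracket_phi hY.isHorizontalField hV hW,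
      h.inner_mlieBracket_vertical hY hV hW, hτ _ V W hY.phi hV hW]
    ring
  have hs : ∀ {Y : ∀ x : M, TangentSpace 𝓘(ℝ, E) x}, IsMuField E' S F Y →
      g.inner x (g.leviCivita V x (S.phi x (Y x))) (S.phi x (W x)) = 0 := by
    intro Y hY
    have h1 := h.mvfderiv_inner_mlieBracket_phi hY hV hW x
    have h2 := h.mvfderiv_inner_mlieBracket_vertical hY hV hW x
    have hl : MDifferentiableAt 𝓘(ℝ, E) 𝓘(ℝ)
        (fun y ↦ g.inner y (mlieBracket 𝓘(ℝ, E) V Y y) (S.phi y (W y))) x :=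
      (g.contMDiffAt_inner ((hV.1.mlieBracket hY.isHorizontalField.1) x)
        (S.isSmoothField_phi hW.1 x)).mdifferentiableAt (by simp)
    have h3 := mvfderiv_add hl hl
    rw [h.inner_phi_mlieBracket_sub hY hV hW, hτ Y V W hY hV hW,
      hkl hY (h.isVerticalField_verticalLie hV) hW, hkl (h.isMuField_mlieBracket_xi hY) hV hW,
      hkl hY hV (h.isVerticalField_verticalLie hW), funext (hkl hY hV hW)] at h1
    rw [h.inner_phi_mlieBracket_sub hY hW hV, hτ Y W V hY hW hV,
      h.inner_leviCivita_phi_symm hW hV] at h2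
    have h4 := congrArg (fun T : E →L[ℝ] ℝ ↦ T (S.xi x)) h3
    change mvfderiv 𝓘(ℝ, E) (fun y ↦ g.inner y (mlieBracket 𝓘(ℝ, E) V Y y) (S.phi y (W y)) +
        g.inner y (mlieBracket 𝓘(ℝ, E) V Y y) (S.phi y (W y))) x (S.xi x) =
      mvfderiv 𝓘(ℝ, E)
          (fun y ↦ g.inner y (mlieBracket 𝓘(ℝ, E) V Y y) (S.phi y (W y))) x (S.xi x) +
        mvfderiv 𝓘(ℝ, E)
          (fun y ↦ g.inner y (mlieBracket 𝓘(ℝ, E) V Y y) (S.phi y (W y))) x (S.xi x) at h4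
    rw [h4, h2] at h1
    -- The terms in DV, DW and [ξ, Y] match, leaving 2α(φY) = -4α(φY).
    linarith
  -- Applied to φY in place of Y, this yields α(-Y) = 0.
  have h5 := hs hY.phi
  rw [phi_phi_of_eta_eq_zero (hY.eta_eq_zero x)] at h5
  simpa using h5

theorem eta_fieldC (h : IsSasakianSubmersion S gN F) (x : M) :
    S.eta x (S.fieldC h.submersion X x) = 0 := by
  rw [eq_sub_of_add_eq' (S.fieldB_add_fieldC h.submersion X x), map_sub, S.eta_phi (by norm_num),
    h.eta_vertical (v := S.fieldB h.submersion X x) (h.submersion.verticalPart_mem _), sub_zero]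

theorem isMuField_fieldC (h : IsSasakianSubmersion S gN F) (hX : IsHorizontalField E' g F X) :
    IsMuField E' S F (S.fieldC h.submersion X) where
  isHorizontalField := ⟨h.submersion.isSmoothField_horizontalPart (S.isSmoothField_phi hX.1),
    fun _ ↦ h.submersion.horizontalPart_mem _⟩
  phi_mem x v hv := by
    change g.inner x v (S.phi x (S.fieldC h.submersion X x)) = 0
    rw [← neg_eq_zero, ← inner_phi_left_neg]
    exact (S.fieldC_mem_mu h.submersion h.antiInvariant h.xi_mem X x (hX.2 x)).2 _
      (Submodule.mem_map_of_mem hv)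
  eta_eq_zero := h.eta_fieldC

theorem isVerticalField_fieldB (h : IsSasakianSubmersion S gN F) (hX : IsSmoothField X) :
    IsVerticalField E' F (S.fieldB h.submersion X) :=
  ⟨h.submersion.isSmoothField_verticalPart (S.isSmoothField_phi hX),
    fun _ ↦ h.submersion.verticalPart_mem _⟩

theorem isTotallyGeodesicFoliation_iff (h : IsSasakianSubmersion S gN F) :
    IsTotallyGeodesicFoliation g (vertical E E' F) ↔
      ∀ X V W : ∀ x : M, TangentSpace 𝓘(ℝ, E) x, IsHorizontalField E' g F X →
        IsVerticalField E' F V → IsVerticalField E' F W → ∀ x,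
        g.inner x (g.leviCivita V x (S.phi x (X x))) (S.phi x (W x)) = 0 := by
  constructor
  · intro ha X V W hX hV hW x
    have hB := h.isVerticalField_fieldB hX.1
    -- The BX part is vertical, where total geodesy applies directly; only the CX part, in μ, needs
    -- the ξ-derivative argument.
    rw [← S.fieldB_add_fieldC h.submersion X x, map_add, map_add, _root_.add_apply,
      inner_eq_zero_of_vertical_of_horizontal (ha _ V hB.1 hV.1 hB.2 hV.2 x).2
        (h.antiInvariant x _ (hW.2 x)), zero_add]
    refine h.inner_leviCivita_mu_eq_zero (fun Y V W hY hV hW x ↦ ?_) (h.isMuField_fieldC hX) hV hW x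
    exact inner_eq_zero_of_vertical_of_horizontal (ha V W hV.1 hW.1 hV.2 hW.2 x).2
      (hY.isHorizontalField.2 x)
  · intro hP V W hVs hWs hVm hWm x
    have hV : IsVerticalField E' F V := ⟨hVs, hVm⟩
    have hW : IsVerticalField E' F W := ⟨hWs, hWm⟩
    refine ⟨h.submersion.mlieBracket_mem_vertical hV hW x,
      h.submersion.mem_vertical_of_inner fun w hw ↦ ?_⟩
    obtain ⟨X, hX, rfl⟩ := h.submersion.exists_isHorizontalField_eq hw
    have hB := h.isVerticalField_fieldB hX.1
    have hC := h.isMuField_fieldC hX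
    have h1 : g.inner x (g.leviCivita W x (V x)) (S.phi x (S.fieldB h.submersion X x)) = 0 := by
      -- P is used with X = φV, for which φX = -V.
      have := hP _ W _ (h.antiInvariant.isHorizontalField_phi hV) hW hB x
      rwa [phi_phi_of_eta_eq_zero (h.eta_vertical (hVm x)), map_neg, map_neg, _root_.neg_apply,
        neg_eq_zero] at this
    have h2 : g.inner x (g.leviCivita W x (V x)) (S.phi x (S.fieldC h.submersion X x)) = 0 := by
      refine h.inner_leviCivita_eq_zero_of_mu (fun Y V W hY hV hW x ↦ ?_) hC.phi hV hW x
      -- P is used with X = φY, for which φX = -Y.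
      have := hP _ V W hY.phi.isHorizontalField hV hW x
      rwa [phi_phi_of_eta_eq_zero (hY.eta_eq_zero x), map_neg, map_neg, _root_.neg_apply,
        neg_eq_zero] at this
    have h3 : g.inner x (g.leviCivita W x (V x)) (S.xi x) = 0 := by
      rw [g.inner_leviCivita_of_inner_eq_const hWs S.xi_smooth
        (fun y ↦ inner_eq_zero_of_vertical_of_horizontal (hWm y) (h.xi_mem y)),
        h.sasakian.leviCivita_xi_eq_neg, map_neg, inner_eq_zero_of_vertical_of_horizontal (hWm x)
          (h.antiInvariant x _ (hVm x)), neg_zero, neg_zero]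
    -- The identity φBX + φCX = -X + η(X)ξ writes X through the three directions treated in `h1`,
    -- `h2` and `h3`.
    have h4 := congrArg (g.inner x (g.leviCivita W x (V x))) (S.phi_phi x (X x))
    rw [← S.fieldB_add_fieldC h.submersion X x, map_add, map_add, map_add, h1, h2, map_smul,
      map_smul, h3] at h4
    simpa using h4

end IsSasakianSubmersion
end Submersion
end LorentzianAlmostContact
end SemiRiem

end

/-! ### The equivalence of the three conditions -/

theorem mainTheorem8
    {E : Type*} [NormedAddCommGroup E] [NormedSpace ℝ E] [FiniteDimensional ℝ E]
    {M : Type*} [TopologicalSpace M] [T2Space M] [SigmaCompactSpace M] [ChartedSpace E M]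
    [IsManifold 𝓘(ℝ, E) ∞ M]
    {E' : Type*} [NormedAddCommGroup E'] [NormedSpace ℝ E'] [FiniteDimensional ℝ E']
    {N : Type*} [TopologicalSpace N] [T2Space N] [SigmaCompactSpace N] [ChartedSpace E' N]
    [IsManifold 𝓘(ℝ, E') ∞ N]
    (gM : SemiRiem.SemiRiemannianMetric E M) (gN : SemiRiem.SemiRiemannianMetric E' N)
    (ε : ℝ) (hε : ε = -1 ∨ ε = 1)
    (S : SemiRiem.LorentzianAlmostContact gM ε) (hS : S.IsSasakian)
    (hN : gN.IsLorentzian)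
    (F : M → N) (hF : SemiRiem.IsSemiRiemannianSubmersion gM gN F)
    (hanti : S.IsAntiInvariant E' F)
    (hxi : ∀ x, S.xi x ∈ SemiRiem.horizontal E' gM F x) :
    List.TFAE [
      SemiRiem.IsTotallyGeodesicFoliation gM (SemiRiem.vertical E E' F),
      ∀ X V W : ∀ x : M, TangentSpace 𝓘(ℝ, E) x,
        SemiRiem.IsHorizontalField E' gM F X → SemiRiem.IsVerticalField E' F V →
        SemiRiem.IsVerticalField E' F W → ∀ x,
        gN.inner (F x)
          (SemiRiem.secondFundamentalForm gM gN F V (fun y ↦ S.phi y (X y)) x)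
          (mfderiv 𝓘(ℝ, E) 𝓘(ℝ, E') F x (S.phi x (W x))) = 0,
      ∀ X V : ∀ x : M, TangentSpace 𝓘(ℝ, E) x,
        SemiRiem.IsHorizontalField E' gM F X → SemiRiem.IsVerticalField E' F V → ∀ x,
        hF.tensorT V (S.fieldB hF X) x + hF.tensorA (S.fieldC hF X) V x ∈ S.mu E' F x] := by
  have hbP : (∀ X V W : ∀ x : M, TangentSpace 𝓘(ℝ, E) x,
        SemiRiem.IsHorizontalField E' gM F X → SemiRiem.IsVerticalField E' F V →
        SemiRiem.IsVerticalField E' F W → ∀ x,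
        gN.inner (F x)
          (SemiRiem.secondFundamentalForm gM gN F V (fun y ↦ S.phi y (X y)) x)
          (mfderiv 𝓘(ℝ, E) 𝓘(ℝ, E') F x (S.phi x (W x))) = 0) ↔
      ∀ X V W : ∀ x : M, TangentSpace 𝓘(ℝ, E) x,
        SemiRiem.IsHorizontalField E' gM F X → SemiRiem.IsVerticalField E' F V →
        SemiRiem.IsVerticalField E' F W → ∀ x,
        gM.inner x (gM.leviCivita V x (S.phi x (X x))) (S.phi x (W x)) = 0 := by
    refine forall₃_congr fun X V W ↦ forall₄_congr fun hX hV hW x ↦ ?_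
    rw [SemiRiem.LorentzianAlmostContact.inner_secondFundamentalForm hF hanti
      (S.isSmoothField_phi hX.1) hV hW, neg_eq_zero]
  have hcP : (∀ X V : ∀ x : M, TangentSpace 𝓘(ℝ, E) x,
        SemiRiem.IsHorizontalField E' gM F X → SemiRiem.IsVerticalField E' F V → ∀ x,
        hF.tensorT V (S.fieldB hF X) x + hF.tensorA (S.fieldC hF X) V x ∈ S.mu E' F x) ↔
      ∀ X V W : ∀ x : M, TangentSpace 𝓘(ℝ, E) x,
        SemiRiem.IsHorizontalField E' gM F X → SemiRiem.IsVerticalField E' F V →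
        SemiRiem.IsVerticalField E' F W → ∀ x,
        gM.inner x (gM.leviCivita V x (S.phi x (X x))) (S.phi x (W x)) = 0 := by
    refine forall₂_congr fun X V ↦ ⟨fun h W hX hV hW x ↦ ?_, fun h hX hV x ↦ ?_⟩
    · exact (S.tensorT_add_tensorA_mem_mu_iff hF hanti hX.1 hV x).1 (h hX hV x) _ (hW.2 x)
    · refine (S.tensorT_add_tensorA_mem_mu_iff hF hanti hX.1 hV x).2 fun w hw ↦ ?_
      obtain ⟨W, hW, rfl⟩ := hF.exists_isVerticalField_eq hw
      exact h W hX hV hW x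
  rw [hbP, hcP]
  refine List.tfae_cons_cons.2 ⟨?_, List.tfae_cons_cons.2 ⟨Iff.rfl, List.tfae_singleton _⟩⟩
  rcases hε with rfl | rfl
  · exact SemiRiem.LorentzianAlmostContact.IsSasakianSubmersion.isTotallyGeodesicFoliation_iff
      ⟨hS, hF, hanti, hxi⟩
  -- For ε = 1 both sides hold trivially, every vertical vector being zero.
  · have h0 : ∀ x, ∀ v ∈ SemiRiem.vertical E E' F x, v = 0 := fun x v hv ↦
      SemiRiem.LorentzianAlmostContact.IsSasakian.vertical_eq_zero S hS hF hanti hxi hv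
    refine iff_of_true (fun V W hV hW hVm hWm x ↦
      ⟨hF.mlieBracket_mem_vertical ⟨hV, hVm⟩ ⟨hW, hWm⟩ x, ?_⟩) fun X V W _ _ hW x ↦ ?_
    · rw [h0 x _ (hVm x), map_zero]
      exact Submodule.zero_mem _
    · rw [h0 x _ (hW.2 x), map_zero, map_zero]
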